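/- **Setting.** Let $X\in\mathbb R^{n\times d}$, $\mathbf Y\in\mathbb R^n$, $\mathbb X=X^{\mathsf t}X$, and let $D$ be a random $n\times n$ diagonal matrix. Norms of matrices are spectral norms, $A^+$ is the Moore–Penrose inverse and $\sigma^+_{\min}(A)$ the smallest non-zero singular value of $A$. Write $M_2=\mathbb E[D^2]$, $\widehat{\mathbb X}=X^{\mathsf t}M_2X$, $\widehat{\mathbf w}=(M_2^{1/2}X)^+M_2^{1/2}\mathbf Y$, and let $\Sigma_D$ be the covariance matrix of $(D_{11}^2,\dots,D_{nn}^2)$. For a constant step size $\alpha>0$, i.i.d. copies $D_1,D_2,\dots$ of $D$, and an initial vector $\widehat{\mathbf w}_1$ independent of $(D_k)_{k\ge1}$, set $$\widehat{\mathbf w}_{k+1}=(I-\alpha X^{\mathsf t}D_k^2X)\,\widehat{\mathbf w}_k+\alpha X^{\mathsf t}D_k^2\mathbf Y,\qquad k\ge1,$$ and let $\widehat\mu_k$ be the law of $\widehat{\mathbf w}_k$. Let $\mathcal W_2$ be the $2$-transportation (Wasserstein) distance on $\mathbb R^d$. **Assumptions.** (a) $\widehat{\mathbf w}_1\perp\ker(X)$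 almost surely and $\mathbb E\|\widehat{\mathbf w}_1\|_2^2<\infty$; (b) $\|D\|\le\tau$ almost surely and $M_2$ is non-singular; (c) $\alpha\|\widehat{\mathbb X}\|<1$, $\alpha\tau^2\|\mathbb X\|<2$, and $$\alpha<\frac{\sigma^+_{\min}(\widehat{\mathbb X})}{\sigma^+_{\min}(\widehat{\mathbb X})^2+\|X\|^4\|\Sigma_D\|};$$ (d) $\mathbf Y-X\widehat{\mathbf w}\ne\mathbf 0$. **Theorem.** There are a constant $C_3>0$, depending only on $X,\mathbf Y,\alpha,\tau$ and the law of $\widehat{\mathbf w}_1$, and a stationary distribution $\widehat\mu_\infty$ of the iteration, concentrated on $\ker(X)^\perp$, with $$\mathcal W_2(\widehat\mu_k,\widehat\mu_\infty)\le C_3\exp\Big(-\tfrac12\,\alpha\,(2-\alpha\tau^2\|\mathbb X\|)\,\sigma^+_{\min}(\widehat{\mathbb X})\,k\Big)\qquad\text{for all }k\ge1,$$ such that the following holds for every $\varepsilon>0$. If $$\alpha\le\frac{\sigma^+_{\min}(\widehat{\mathbb X})\,\varepsilon^2}{d\,\|\Sigma_D\|\,\|\mathbb X\|\,\|\mathbf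 Y-X\widehat{\mathbf w}\|_2^2}$$ (no condition if $\Sigma_D=0$), then for all integers $k\ge1$ with $$k>\frac{2\log(2C_3/\varepsilon)}{\alpha\,(2-\alpha\tau^2\|\mathbb X\|)\,\sigma^+_{\min}(\widehat{\mathbb X})}$$ we have $\mathcal W_2(\widehat\mu_k,\delta_{\widehat{\mathbf w}})<\varepsilon$, where $\delta_{\widehat{\mathbf w}}$ is the point mass at $\widehat{\mathbf w}$. -/

import Mathlib

open MeasureTheory ProbabilityTheory Matrix
open scoped ENNReal Matrix.Norms.L2Operator

noncomputable section

/- With the scope `Matrix.Norms.L2Operator` open, `‖A‖` is the spectral norm of a matrix `A`. -/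

/-- The smallest non-zero singular value of a real matrix. -/
def sigmaMinPos {m n : ℕ} (A : Matrix (Fin m) (Fin n) ℝ) : ℝ :=
  sInf {s : ℝ | s ≠ 0 ∧ ∃ i : ℕ, (toEuclideanLin A).singularValues i = s}

/-- The pseudo-inverse `A⁺` of a real matrix. If `AᴴA = U diag(lam) Uᴴ` is the spectral
decomposition, then `A⁺ = U diag(lam⁻¹) Uᴴ Aᴴ`, where `0⁻¹ = 0`; in terms of a singular value
decomposition `A = V S Uᴴ` this is `U S⁺ Vᴴ`. -/
def pinv {m n : ℕ} (A : Matrix (Fin m) (Fin n) ℝ) : Matrix (Fin n) (Fin m) ℝ :=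
  let h := isHermitian_conjTranspose_mul_self A
  (h.eigenvectorUnitary : Matrix (Fin n) (Fin n) ℝ) *
    diagonal (fun i => (h.eigenvalues i)⁻¹) *
    (h.eigenvectorUnitary : Matrix (Fin n) (Fin n) ℝ)ᴴ * Aᴴ

/-- The four equations of Penrose, which characterize the pseudo-inverse. -/
theorem pinv_penrose {m n : ℕ} (A : Matrix (Fin m) (Fin n) ℝ) :
    A * pinv A * A = A ∧ pinv A * A * pinv A = pinv A ∧
      (A * pinv A)ᴴ = A * pinv A ∧ (pinv A * A)ᴴ = pinv A * A := by
  set h := isHermitian_conjTranspose_mul_self A with hh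
  set U : Matrix (Fin n) (Fin n) ℝ := (h.eigenvectorUnitary : Matrix (Fin n) (Fin n) ℝ) with hU
  set L : Matrix (Fin n) (Fin n) ℝ := diagonal h.eigenvalues with hL
  set J : Matrix (Fin n) (Fin n) ℝ := diagonal (fun i => (h.eigenvalues i)⁻¹) with hJ
  have hUU : Uᴴ * U = 1 := Unitary.coe_star_mul_self h.eigenvectorUnitary
  have hG : Aᴴ * A = U * L * Uᴴ := by
    have := h.spectral_theorem
    rw [Unitary.conjStarAlgAut_apply] at this
    exact this
  have hLH : Lᴴ = L := by simp [hL]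
  have hJH : Jᴴ = J := by simp [hJ]
  have hLJ : L * J = J * L := by
    simp only [hL, hJ, diagonal_mul_diagonal]; congr 1; ext i; ring
  have hinv : ∀ x : ℝ, x⁻¹ * x * x⁻¹ = x⁻¹ ∧ x⁻¹ * x * x = x := by
    intro x
    rcases eq_or_ne x 0 with rfl | h0
    · simp
    · constructor <;> field_simp
  have hJLJ : J * L * J = J := by
    simp only [hL, hJ, diagonal_mul_diagonal]; congr 1; ext i
    exact (hinv _).1
  have hJLL : J * L * L = L := by
    simp only [hL, hJ, diagonal_mul_diagonal]; congr 1; ext i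
    exact (hinv _).2
  have hP : pinv A = U * J * Uᴴ * Aᴴ := rfl
  have hPA : pinv A * A = U * (J * L) * Uᴴ := by
    rw [hP, Matrix.mul_assoc _ Aᴴ A, hG]
    calc U * J * Uᴴ * (U * L * Uᴴ) = U * J * (Uᴴ * U) * L * Uᴴ := by noncomm_ring
      _ = _ := by rw [hUU]; noncomm_ring
  have hPAH : (pinv A * A)ᴴ = pinv A * A := by
    rw [hPA]
    simp only [conjTranspose_mul, conjTranspose_conjTranspose, hLH, hJH, hLJ, Matrix.mul_assoc]
  have hGPA : Aᴴ * A * (pinv A * A) = Aᴴ * A := by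
    rw [hPA, hG]
    calc U * L * Uᴴ * (U * (J * L) * Uᴴ) = U * L * (Uᴴ * U) * (J * L) * Uᴴ := by noncomm_ring
      _ = U * (L * J * L) * Uᴴ := by rw [hUU]; noncomm_ring
      _ = _ := by rw [hLJ, hJLL]
  refine ⟨?_, ?_, ?_, hPAH⟩
  · have h0 : (A * (pinv A * A) - A)ᴴ * (A * (pinv A * A) - A) = 0 := by
      rw [conjTranspose_sub, conjTranspose_mul, hPAH]
      have : ((pinv A * A) * Aᴴ - Aᴴ) * (A * (pinv A * A) - A)
          = (pinv A * A) * (Aᴴ * A * (pinv A * A)) - (pinv A * A) * (Aᴴ * A)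
            - (Aᴴ * A * (pinv A * A)) + Aᴴ * A := by
        simp only [Matrix.sub_mul, Matrix.mul_sub, Matrix.mul_assoc]; abel
      rw [this, hGPA]; abel
    rw [Matrix.mul_assoc]
    exact sub_eq_zero.mp (conjTranspose_mul_self_eq_zero.mp h0)
  · rw [hPA, hP]
    calc U * (J * L) * Uᴴ * (U * J * Uᴴ * Aᴴ) = U * (J * L) * (Uᴴ * U) * J * Uᴴ * Aᴴ := by
          simp only [Matrix.mul_assoc]
      _ = U * (J * L * J) * Uᴴ * Aᴴ := by rw [hUU]; simp only [Matrix.mul_assoc, Matrix.one_mul]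
      _ = _ := by rw [hJLJ]
  · rw [hP]
    simp only [conjTranspose_mul, conjTranspose_conjTranspose, hJH, Matrix.mul_assoc]

/- A random diagonal matrix `D` is given through the random vector of its diagonal entries, with law
`ν` on `Fin n → ℝ`. -/

/-- The second moment `M₂ = E[D²]`. -/
def secondMoment {n : ℕ} (ν : Measure (Fin n → ℝ)) : Matrix (Fin n) (Fin n) ℝ :=
  diagonal (fun i => ∫ x, x i ^ 2 ∂ν)

/-- The positive semi-definite square root of the diagonal matrix `M₂`. -/
def sqrtSecondMoment {n : ℕ} (ν : Measure (Fin n → ℝ)) : Matrix (Fin n) (Fin n) ℝ :=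
  diagonal (fun i => √(∫ x, x i ^ 2 ∂ν))

/-- The covariance matrix `Σ_D` of the random vector `(D₁₁², …, Dₙₙ²)`. -/
def covSq {n : ℕ} (ν : Measure (Fin n → ℝ)) : Matrix (Fin n) (Fin n) ℝ :=
  Matrix.of fun i j => cov[fun x => x i ^ 2, fun x => x j ^ 2; ν]

/-- The weighted Gram matrix `Xᵀ M₂ X`. -/
def weightedGram {n d : ℕ} (X : Matrix (Fin n) (Fin d) ℝ) (ν : Measure (Fin n → ℝ)) :
    Matrix (Fin d) (Fin d) ℝ :=
  Xᵀ * secondMoment ν * X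

/-- The weighted minimum-norm least squares estimator `ŵ = (M₂^{1/2} X)⁺ M₂^{1/2} Y`. -/
def wHat {n d : ℕ} (X : Matrix (Fin n) (Fin d) ℝ) (Y : EuclideanSpace ℝ (Fin n))
    (ν : Measure (Fin n → ℝ)) : EuclideanSpace ℝ (Fin d) :=
  toEuclideanLin (pinv (sqrtSecondMoment ν * X)) (toEuclideanLin (sqrtSecondMoment ν) Y)

/-- One randomly weighted gradient step `(I - α Xᵀ D² X) w + α Xᵀ D² Y` with weighting matrix
`D = diag(δ)`, that is, `w - (α / 2) ∇_w ‖D (Y - X w)‖²`. -/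
def wgdStep {n d : ℕ} (X : Matrix (Fin n) (Fin d) ℝ) (Y : EuclideanSpace ℝ (Fin n)) (α : ℝ)
    (δ : Fin n → ℝ) (w : EuclideanSpace ℝ (Fin d)) : EuclideanSpace ℝ (Fin d) :=
  toEuclideanLin (1 - α • (Xᵀ * diagonal δ ^ 2 * X)) w
    + α • toEuclideanLin (Xᵀ * diagonal δ ^ 2) Y

/-- The randomly weighted gradient descent iterates with constant step size `α`, started from `w₁`.
Indices are shifted by one: `D k` is the weighting matrix `D_{k+1}`, and `wgdIter X Y α D w₁ k` is
the iterate `ŵ_{k+1}`, reached from `ŵ₁ = w₁` after `k` steps. -/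
def wgdIter {n d : ℕ} {Ω : Type*} (X : Matrix (Fin n) (Fin d) ℝ) (Y : EuclideanSpace ℝ (Fin n))
    (α : ℝ) (D : ℕ → Ω → Fin n → ℝ) (w₁ : Ω → EuclideanSpace ℝ (Fin d)) :
    ℕ → Ω → EuclideanSpace ℝ (Fin d)
  | 0 => w₁
  | k + 1 => fun ω => wgdStep X Y α (D k ω) (wgdIter X Y α D w₁ k ω)

/-- A probability measure `π` is stationary for the iteration with weightings of law `ν`, if a step
from `w ∼ π`, with an independent `D ∼ ν`, again has law `π`. -/
def IsStationaryLaw {n d : ℕ} (X : Matrix (Fin n) (Fin d) ℝ) (Y : EuclideanSpace ℝ (Fin n)) (α : ℝ)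
    (ν : Measure (Fin n → ℝ)) (π : Measure (EuclideanSpace ℝ (Fin d))) : Prop :=
  IsProbabilityMeasure π ∧ (ν.prod π).map (fun p => wgdStep X Y α p.1 p.2) = π

/-- The transportation distance `W_q`, as an extended non-negative real: the infimum of
`(∫ ‖u - v‖^q dγ(u, v))^{1/q}` over all couplings `γ` of `μ` and `π`. -/
def wasserstein {d : ℕ} (q : ℝ) (μ π : Measure (EuclideanSpace ℝ (Fin d))) : ℝ≥0∞ :=
  ⨅ (γ : Measure (EuclideanSpace ℝ (Fin d) × EuclideanSpace ℝ (Fin d)))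
    (_ : IsProbabilityMeasure γ ∧ γ.fst = μ ∧ γ.snd = π),
    (∫⁻ p, ‖p.1 - p.2‖ₑ ^ q ∂γ) ^ (1 / q)

end

/-! Write σ for the smallest non-zero singular value of the weighted Gram matrix, κ = 2 - ατ²‖XᵀX‖,
r = Y - Xŵ, and Q for `noiseForm`. Everything takes place on ker(X)ᗮ, which every step preserves.

Two points moved by the same random step approach each other: D⁴ ≤ τ²D² gives E‖(I - αXᵀD²X)u‖² ≤
e^{-ακσ}‖u‖² on ker(X)ᗮ (`lintegral_step_sq_le`). Hence backward iterates, in which new randomness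
enters innermost, converge almost surely. Their limit has a stationary law
(`exists_isStationaryLaw`), and coupling through common weightings gives the geometric rate
(`exists_coupling_iterate_stepLaw`).

The distance from the stationary law to ŵ is a variance. By the normal equations a step is the
deterministic gradient step plus centered noise, so laws with mean ŵ keep that mean. Their mean
square distance s to ŵ becomes at most (1 - ασ)s + α²Q(r), because the step-size condition lets the
contraction absorb the noise that depends on the current point (`IsCenteredLaw.step`). Starting at
ŵ, s stays below the fixed point αQ(r)/σ, and Fatou passes this bound to the limit.

Two points need extra care. First, C₃ may not depend on the law of D. Weighted least squares
solutions are bounded uniformly in the weights, by compactness, and the step-size condition turns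
αQ(r)/σ into a quantity free of σ and Σ_D (`exists_uniform_bounds`). Second, the condition on ε
directly gives only αQ(r)/σ ≤ ε², which leaves no room for the transient term. The normal equations
improve this to θε² with θ < 1 depending only on X (`exists_sum_row_norm_mul_residual_sq_le`);
enlarging C₃ by 1/(1 - √θ) then makes the two errors add up to less than ε. -/

/-! ### Spectral bounds and the gradient form of a step. -/

section LinearAlgebra

variable {n d : ℕ}

/-- Non-zero eigenvalues of a positive operator are singular values. -/
theorem sigmaMinPos_le_eigenvalues {A : Matrix (Fin d) (Fin d) ℝ}
    (hA : (toEuclideanLin A).IsPositive) {N : ℕ}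
    (hN : Module.finrank ℝ (EuclideanSpace ℝ (Fin d)) = N) (i : Fin N)
    (hi : hA.isSymmetric.eigenvalues hN i ≠ 0) :
    sigmaMinPos A ≤ hA.isSymmetric.eigenvalues hN i := by
  set T := toEuclideanLin A with hT
  set l := hA.isSymmetric.eigenvalues hN i with hl
  have hl0 : 0 ≤ l := hA.nonneg_eigenvalues hN i
  refine csInf_le ⟨0, ?_⟩ ⟨hi, ?_⟩
  · rintro s ⟨-, j, rfl⟩
    exact LinearMap.singularValues_nonneg _ j
  · have hev : T (hA.isSymmetric.eigenvectorBasis hN i)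
        = l • hA.isSymmetric.eigenvectorBasis hN i :=
      hA.isSymmetric.apply_eigenvectorBasis hN i
    have hev2 : Module.End.HasEigenvalue (LinearMap.adjoint T ∘ₗ T) (l ^ 2) := by
      refine Module.End.hasEigenvalue_of_hasEigenvector
        (x := hA.isSymmetric.eigenvectorBasis hN i) ⟨?_, ?_⟩
      · have hadj : LinearMap.adjoint T = T := (LinearMap.isSymmetric_iff_isSelfAdjoint T).1 hA.isSymmetric
        rw [Module.End.mem_eigenspace_iff, hadj, LinearMap.comp_apply, hev, map_smul, hev,
          smul_smul, sq]
      · exact (hA.isSymmetric.eigenvectorBasis hN).orthonormal.ne_zero i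
    obtain ⟨j, hj⟩ := (T.isSymmetric_adjoint_comp_self).exists_eigenvalues_eq hN hev2
    refine ⟨j, ?_⟩
    rw [T.singularValues_fin hN]
    have : T.isSymmetric_adjoint_comp_self.eigenvalues hN j = l ^ 2 := by simpa using hj
    rw [this, Real.sqrt_sq hl0]

theorem norm_toEuclideanLin_le {m : ℕ} (X : Matrix (Fin n) (Fin m) ℝ)
    (u : EuclideanSpace ℝ (Fin m)) : ‖toEuclideanLin X u‖ ≤ ‖X‖ * ‖u‖ := 
  l2_opNorm_mulVec X u

theorem eigenvalues_le_norm {A : Matrix (Fin d) (Fin d) ℝ}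
    (hA : (toEuclideanLin A).IsSymmetric) {N : ℕ}
    (hN : Module.finrank ℝ (EuclideanSpace ℝ (Fin d)) = N) (i : Fin N) :
    hA.eigenvalues hN i ≤ ‖A‖ := by
  have h := norm_toEuclideanLin_le A (hA.eigenvectorBasis hN i)
  rw [hA.apply_eigenvectorBasis hN i, norm_smul, (hA.eigenvectorBasis hN).norm_eq_one] at h
  simp only [mul_one] at h
  exact (le_abs_self _).trans (by simpa using h)

/-- In an eigenbasis of A, orthogonality to the kernel removes the coordinates with eigenvalue 0,
and the remaining eigenvalues lie between `sigmaMinPos A` and ‖A‖. The condition α‖A‖ ≤ 1 keeps each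
1 - αλ non-negative, so its square is largest at the smallest λ. -/
theorem sigmaMinPos_mul_norm_sq_le {A : Matrix (Fin d) (Fin d) ℝ}
    (hA : (toEuclideanLin A).IsPositive) {u : EuclideanSpace ℝ (Fin d)}
    (hu : u ∈ (LinearMap.ker (toEuclideanLin A))ᗮ) :
    sigmaMinPos A * ‖u‖ ^ 2 ≤ inner ℝ (toEuclideanLin A u) u ∧
      ∀ α : ℝ, 0 ≤ α → α * ‖A‖ ≤ 1 →
        ‖u - α • toEuclideanLin A u‖ ^ 2 ≤ (1 - α * sigmaMinPos A) ^ 2 * ‖u‖ ^ 2 := by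
  set T := toEuclideanLin A with hT
  set b := hA.isSymmetric.eigenvectorBasis rfl with hb
  set l := hA.isSymmetric.eigenvalues rfl with hl
  have hTb : ∀ i, inner ℝ (b i) (T u) = l i * inner ℝ (b i) u := by
    intro i
    rw [← hA.isSymmetric, hA.isSymmetric.apply_eigenvectorBasis rfl i]
    simp [inner_smul_left, hb, hl]
  have hz : ∀ i, l i = 0 → inner ℝ (b i) u = 0 := by
    intro i hi
    refine (Submodule.mem_orthogonal _ _).1 hu _ ?_
    rw [LinearMap.mem_ker, hA.isSymmetric.apply_eigenvectorBasis rfl i]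
    have hi' : hA.isSymmetric.eigenvalues rfl i = 0 := hi
    simp [hi']
  have hnorm : ∀ v, ‖v‖ ^ 2 = ∑ i, (inner ℝ (b i) v) ^ 2 := by
    intro v
    rw [← b.sum_sq_norm_inner_right v]
    simp
  constructor
  · have h1 : inner ℝ (T u) u = ∑ i, l i * (inner ℝ (b i) u) ^ 2 := by
      rw [← b.sum_inner_mul_inner]
      refine Finset.sum_congr rfl fun i _ => ?_
      rw [real_inner_comm, hTb]; ring
    rw [h1, hnorm u, Finset.mul_sum]
    refine Finset.sum_le_sum fun i _ => ?_
    by_cases hi : l i = 0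
    · simp [hz i hi]
    · exact mul_le_mul_of_nonneg_right (sigmaMinPos_le_eigenvalues hA rfl i hi) (sq_nonneg _)
  · intro α hα hα1
    rw [hnorm u, hnorm, Finset.mul_sum]
    refine Finset.sum_le_sum fun i _ => ?_
    rw [inner_sub_right, inner_smul_right, hTb]
    by_cases hi : l i = 0
    · simp [hz i hi]
    · have h1 : sigmaMinPos A ≤ l i := sigmaMinPos_le_eigenvalues hA rfl i hi
      have h2 : l i ≤ ‖A‖ := eigenvalues_le_norm hA.isSymmetric rfl i
      have h3 : α * sigmaMinPos A ≤ α * l i := mul_le_mul_of_nonneg_left h1 hα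
      have h4 : α * l i ≤ 1 := (mul_le_mul_of_nonneg_left h2 hα).trans hα1
      have : (inner ℝ (b i) u - α * (l i * inner ℝ (b i) u)) ^ 2
          = (1 - α * l i) ^ 2 * (inner ℝ (b i) u) ^ 2 := by ring
      rw [this]
      refine mul_le_mul_of_nonneg_right ?_ (sq_nonneg _)
      exact pow_le_pow_left₀ (by linarith) (by linarith) 2

/-- The map `q ↦ Xᵀ q`, on plain vectors. -/
noncomputable def gradVec (X : Matrix (Fin n) (Fin d) ℝ) :
    (Fin n → ℝ) →ₗ[ℝ] EuclideanSpace ℝ (Fin d) :=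
  toEuclideanLin Xᵀ ∘ₗ (WithLp.linearEquiv 2 ℝ (Fin n → ℝ)).symm.toLinearMap

theorem gradVec_apply (X : Matrix (Fin n) (Fin d) ℝ) (q : Fin n → ℝ) (l : Fin d) :
    gradVec X q l = ∑ i, X i l * q i := by
  simp [gradVec, mulVec, dotProduct]

theorem inner_gradVec (X : Matrix (Fin n) (Fin d) ℝ) (q : Fin n → ℝ)
    (u : EuclideanSpace ℝ (Fin d)) :
    inner ℝ (gradVec X q) u = ∑ i, q i * toEuclideanLin X u i := by
  simp only [PiLp.inner_apply, gradVec_apply, toLpLin_apply, mulVec, dotProduct]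
  simp only [RCLike.inner_apply, conj_trivial, Finset.mul_sum]
  rw [Finset.sum_comm]
  exact Finset.sum_congr rfl fun i _ => Finset.sum_congr rfl fun j _ => by ring

theorem norm_transpose_mul_self (X : Matrix (Fin n) (Fin d) ℝ) : ‖Xᵀ * X‖ = ‖X‖ ^ 2 := by
  rw [← conjTranspose_eq_transpose_of_trivial, l2_opNorm_conjTranspose_mul_self, sq]

theorem norm_gradVec_sq_le (X : Matrix (Fin n) (Fin d) ℝ) (q : Fin n → ℝ) :
    ‖gradVec X q‖ ^ 2 ≤ ‖Xᵀ * X‖ * ∑ i, q i ^ 2 := by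
  have h : ‖gradVec X q‖ ≤ ‖X‖ * ‖(WithLp.toLp 2 q : EuclideanSpace ℝ (Fin n))‖ := by
    have := norm_toEuclideanLin_le Xᵀ (WithLp.toLp 2 q)
    rwa [← conjTranspose_eq_transpose_of_trivial, l2_opNorm_conjTranspose] at this
  calc ‖gradVec X q‖ ^ 2 ≤ (‖X‖ * ‖(WithLp.toLp 2 q : EuclideanSpace ℝ (Fin n))‖) ^ 2 :=
        pow_le_pow_left₀ (norm_nonneg _) h 2
    _ = _ := by rw [mul_pow, norm_transpose_mul_self, EuclideanSpace.real_norm_sq_eq]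

theorem norm_gradVec_sq (X : Matrix (Fin n) (Fin d) ℝ) (q : Fin n → ℝ) :
    ‖gradVec X q‖ ^ 2 = ∑ i, ∑ j, (X * Xᵀ) i j * (q i * q j) := by
  rw [EuclideanSpace.real_norm_sq_eq]
  simp only [gradVec_apply, sq, mul_apply, transpose_apply, Finset.sum_mul_sum]
  rw [Finset.sum_comm]
  refine Finset.sum_congr rfl fun i _ => ?_
  rw [Finset.sum_comm]
  refine Finset.sum_congr rfl fun j _ => ?_
  rw [Finset.sum_mul]
  exact Finset.sum_congr rfl fun l _ => by ring

theorem sum_toEuclideanLin_sq_le (X : Matrix (Fin n) (Fin d) ℝ) (u : EuclideanSpace ℝ (Fin d)) :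
    ∑ i, toEuclideanLin X u i ^ 2 ≤ ‖Xᵀ * X‖ * ‖u‖ ^ 2 := by
  rw [← EuclideanSpace.real_norm_sq_eq, norm_transpose_mul_self, ← mul_pow]
  exact pow_le_pow_left₀ (norm_nonneg _) (norm_toEuclideanLin_le X u) 2

theorem gradVec_mem_orthogonal_ker (X : Matrix (Fin n) (Fin d) ℝ) (q : Fin n → ℝ) :
    gradVec X q ∈ (LinearMap.ker (toEuclideanLin X))ᗮ := by
  rw [Submodule.mem_orthogonal']
  intro u hu
  rw [inner_gradVec, LinearMap.mem_ker.1 hu]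
  simp

/-- With the step written as Xᵀ applied to a weighted residual, recentering and differences of steps
become coordinatewise identities in `Fin n → ℝ`. -/
theorem wgdStep_eq (X : Matrix (Fin n) (Fin d) ℝ) (Y : EuclideanSpace ℝ (Fin n)) (α : ℝ)
    (δ : Fin n → ℝ) (w : EuclideanSpace ℝ (Fin d)) :
    wgdStep X Y α δ w = w - α • gradVec X (fun i => δ i ^ 2 * (toEuclideanLin X w i - Y i)) := by
  have h : ∀ y : EuclideanSpace ℝ (Fin n), toEuclideanLin (Xᵀ * diagonal δ ^ 2) y
      = gradVec X (fun i => δ i ^ 2 * y i) := by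
    intro y
    have h2 : (diagonal δ ^ 2) *ᵥ y.ofLp = fun i => δ i ^ 2 * y i := by
      ext i; rw [diagonal_pow, mulVec_diagonal]; simp
    rw [toLpLin_apply, ← mulVec_mulVec, h2]
    rfl
  have h3 : toEuclideanLin (1 - α • (Xᵀ * diagonal δ ^ 2 * X)) w
      = w - α • toEuclideanLin (Xᵀ * diagonal δ ^ 2) (toEuclideanLin X w) := by
    simp only [toLpLin_apply, sub_mulVec, smul_mulVec, one_mulVec, ← mulVec_mulVec]
    rfl
  rw [wgdStep, h3, h, h, sub_add, ← smul_sub, ← map_sub]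
  congr 3
  ext i
  simp [mul_sub]

theorem gradVec_continuous (X : Matrix (Fin n) (Fin d) ℝ) : Continuous (gradVec X) :=
  LinearMap.continuous_of_finiteDimensional _

end LinearAlgebra

/-! ### Weighted least squares, with bounds uniform in the weights. -/

section WeightedLeastSquares

open Filter Topology

variable {n d : ℕ}

theorem continuous_toEuclideanLin_coord (X : Matrix (Fin n) (Fin d) ℝ) (i : Fin n) :
    Continuous fun u : EuclideanSpace ℝ (Fin d) => toEuclideanLin X u i :=
  (PiLp.continuous_apply 2 (fun _ : Fin n => ℝ) i).comp
    (LinearMap.continuous_of_finiteDimensional (toEuclideanLin X))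

/-- The left side is ‖Xᵀeᵢ‖² for the i-th unit vector. -/
theorem row_norm_sq_le (X : Matrix (Fin n) (Fin d) ℝ) (i : Fin n) :
    (X * Xᵀ) i i ≤ ‖Xᵀ * X‖ := by
  have h := norm_gradVec_sq_le X (Pi.single i 1)
  rw [norm_gradVec_sq] at h
  simpa [Pi.single_apply, ite_pow] using h

theorem weightedGram_apply (X : Matrix (Fin n) (Fin d) ℝ) (ν : Measure (Fin n → ℝ))
    (u : EuclideanSpace ℝ (Fin d)) :
    toEuclideanLin (weightedGram X ν) u
      = gradVec X (fun i => (∫ x, x i ^ 2 ∂ν) * toEuclideanLin X u i) := by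
  have h : secondMoment ν *ᵥ (X *ᵥ u.ofLp)
      = fun i => (∫ x, x i ^ 2 ∂ν) * toEuclideanLin X u i := by
    ext i; rw [secondMoment, mulVec_diagonal]; rfl
  rw [toLpLin_apply, weightedGram, ← mulVec_mulVec, ← mulVec_mulVec, h]
  rfl

theorem inner_weightedGram_apply (X : Matrix (Fin n) (Fin d) ℝ) (ν : Measure (Fin n → ℝ))
    (u v : EuclideanSpace ℝ (Fin d)) :
    inner ℝ (toEuclideanLin (weightedGram X ν) u) v
      = ∑ i, (∫ x, x i ^ 2 ∂ν) * (toEuclideanLin X u i * toEuclideanLin X v i) := by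
  rw [weightedGram_apply, inner_gradVec]
  simp only [mul_assoc]

theorem isPositive_weightedGram (X : Matrix (Fin n) (Fin d) ℝ) (ν : Measure (Fin n → ℝ)) :
    (toEuclideanLin (weightedGram X ν)).IsPositive := by
  refine ⟨fun u v => ?_, fun u => ?_⟩
  · rw [real_inner_comm _ u, inner_weightedGram_apply, inner_weightedGram_apply]
    exact Finset.sum_congr rfl fun i _ => by ring
  · change 0 ≤ inner ℝ (toEuclideanLin (weightedGram X ν) u) u
    rw [inner_weightedGram_apply]
    exact Finset.sum_nonneg fun i _ =>
      mul_nonneg (integral_nonneg fun x => sq_nonneg _) (mul_self_nonneg _)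

theorem secondMoment_pos {ν : Measure (Fin n → ℝ)} (h : IsUnit (secondMoment ν)) (i : Fin n) :
    0 < ∫ x, x i ^ 2 ∂ν := by
  rw [isUnit_iff_isUnit_det, secondMoment, det_diagonal, isUnit_iff_ne_zero,
    Finset.prod_ne_zero_iff] at h
  exact lt_of_le_of_ne (integral_nonneg fun x => sq_nonneg _) (h i (Finset.mem_univ _)).symm

/-- If Xᵀ M₂ X v = 0, pairing with v gives ∑ mᵢ (Xv)ᵢ² = 0; since all mᵢ > 0, Xv = 0. -/
theorem mem_orthogonal_ker_weightedGram {X : Matrix (Fin n) (Fin d) ℝ} {ν : Measure (Fin n → ℝ)}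
    (h : IsUnit (secondMoment ν)) {u : EuclideanSpace ℝ (Fin d)}
    (hu : u ∈ (LinearMap.ker (toEuclideanLin X))ᗮ) :
    u ∈ (LinearMap.ker (toEuclideanLin (weightedGram X ν)))ᗮ := by
  refine Submodule.orthogonal_le (fun v hv => ?_) hu
  have h0 : ∑ i, (∫ x, x i ^ 2 ∂ν) * (toEuclideanLin X v i * toEuclideanLin X v i) = 0 := by
    rw [← inner_weightedGram_apply, LinearMap.mem_ker.1 hv, inner_zero_left]
  rw [Finset.sum_eq_zero_iff_of_nonneg fun i _ =>
    mul_nonneg (secondMoment_pos h i).le (mul_self_nonneg _)] at h0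
  rw [LinearMap.mem_ker]
  ext i
  simpa [(secondMoment_pos h i).ne'] using h0 i (Finset.mem_univ i)

theorem sqrtSecondMoment_mul_self (ν : Measure (Fin n → ℝ)) :
    sqrtSecondMoment ν * sqrtSecondMoment ν = secondMoment ν := by
  rw [sqrtSecondMoment, secondMoment, diagonal_mul_diagonal]
  congr 1
  ext i
  exact Real.mul_self_sqrt (integral_nonneg fun x => sq_nonneg _)

theorem sqrtSecondMoment_conjTranspose (ν : Measure (Fin n → ℝ)) :
    (sqrtSecondMoment ν)ᴴ = sqrtSecondMoment ν := by
  rw [sqrtSecondMoment, diagonal_conjTranspose]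
  simp

theorem wHat_mem_orthogonal_ker (X : Matrix (Fin n) (Fin d) ℝ) (Y : EuclideanSpace ℝ (Fin n))
    (ν : Measure (Fin n → ℝ)) : wHat X Y ν ∈ (LinearMap.ker (toEuclideanLin X))ᗮ := by
  set S := sqrtSecondMoment ν
  obtain ⟨-, h2, -, h4⟩ := pinv_penrose (S * X)
  -- Penrose for A = SX: A⁺ = (A⁺A)ᴴA⁺ = Aᴴ(A⁺)ᴴA⁺, so the range of A⁺ lies in that of Xᵀ.
  have h : pinv (S * X) = Xᵀ * (Sᴴ * ((pinv (S * X))ᴴ * pinv (S * X))) := by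
    rw [← h4, conjTranspose_mul, conjTranspose_mul] at h2
    conv_lhs => rw [← h2]
    simp only [Matrix.mul_assoc, conjTranspose_eq_transpose_of_trivial]
  have h3 : wHat X Y ν = gradVec X
      ((Sᴴ * ((pinv (S * X))ᴴ * pinv (S * X))) *ᵥ (toEuclideanLin S Y).ofLp) := by
    have : wHat X Y ν = WithLp.toLp 2 (pinv (S * X) *ᵥ (toEuclideanLin S Y).ofLp) := rfl
    rw [this, h, ← mulVec_mulVec, ← h]
    rfl
  rw [h3]
  exact gradVec_mem_orthogonal_ker _ _

/-- The normal equations. -/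
theorem gradVec_residual_wHat (X : Matrix (Fin n) (Fin d) ℝ) (Y : EuclideanSpace ℝ (Fin n))
    (ν : Measure (Fin n → ℝ)) :
    gradVec X (fun i => (∫ x, x i ^ 2 ∂ν) * (Y - toEuclideanLin X (wHat X Y ν)) i) = 0 := by
  set S := sqrtSecondMoment ν with hS
  obtain ⟨h1, -, h3, -⟩ := pinv_penrose (S * X)
  have h : Xᵀ * (secondMoment ν * (X * (pinv (S * X) * S))) = Xᵀ * secondMoment ν := by
    -- Again for A = SX: since AA⁺ is symmetric, AᴴAA⁺ = (AA⁺A)ᴴ = Aᴴ.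
    have h5 : (S * X)ᴴ * (S * X * pinv (S * X)) = (S * X)ᴴ := by
      rw [← h3, ← conjTranspose_mul, h1]
    rw [conjTranspose_mul, sqrtSecondMoment_conjTranspose,
      conjTranspose_eq_transpose_of_trivial, ← hS] at h5
    have h6 := congrArg (· * S) h5
    simp only [Matrix.mul_assoc] at h6
    simpa only [← sqrtSecondMoment_mul_self, ← hS, Matrix.mul_assoc] using h6
  have hw : (toEuclideanLin X (wHat X Y ν)).ofLp = (X * (pinv (S * X) * S)) *ᵥ Y.ofLp := by
    rw [← mulVec_mulVec, ← mulVec_mulVec]; rfl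
  have h7 : (fun i => (∫ x, x i ^ 2 ∂ν) * (Y - toEuclideanLin X (wHat X Y ν)) i)
      = secondMoment ν *ᵥ Y.ofLp - secondMoment ν *ᵥ ((X * (pinv (S * X) * S)) *ᵥ Y.ofLp) := by
    rw [← hw, ← mulVec_sub]
    ext i; rw [secondMoment, mulVec_diagonal]; rfl
  have h8 : gradVec X (secondMoment ν *ᵥ Y.ofLp)
      = gradVec X (secondMoment ν *ᵥ ((X * (pinv (S * X) * S)) *ᵥ Y.ofLp)) := by
    have h9 : Xᵀ *ᵥ (secondMoment ν *ᵥ Y.ofLp)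
        = Xᵀ *ᵥ (secondMoment ν *ᵥ ((X * (pinv (S * X) * S)) *ᵥ Y.ofLp)) := by
      rw [mulVec_mulVec, mulVec_mulVec, mulVec_mulVec, Matrix.mul_assoc, h]
    exact congrArg (WithLp.toLp 2) h9
  rw [h7, map_sub, h8, sub_self]

/-- Solutions of positively weighted least squares problems are bounded, uniformly in the
weights. -/
theorem exists_norm_weighted_least_squares_le (X : Matrix (Fin n) (Fin d) ℝ)
    (Y : EuclideanSpace ℝ (Fin n)) :
    ∃ C : ℝ, 0 ≤ C ∧ ∀ (m : Fin n → ℝ) (w : EuclideanSpace ℝ (Fin d)), (∀ i, 0 < m i) →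
      w ∈ (LinearMap.ker (toEuclideanLin X))ᗮ →
      gradVec X (fun i => m i * (Y - toEuclideanLin X w) i) = 0 → ‖w‖ ≤ C := by
  by_contra! hcon
  choose m w hm hw hgrad hnorm using fun N : ℕ => hcon (N + 1 : ℝ) (by positivity)
  have hwpos : ∀ N, 0 < ‖w N‖ := fun N => lt_trans (by positivity) (hnorm N)
  -- A sequence of unbounded solutions is normalized; a limit direction u lies in ker(X)ᗮ on the
  -- unit sphere, so Xu ≠ 0. The normal equations are then tested against u.
  set v : ℕ → EuclideanSpace ℝ (Fin d) := fun N => (‖w N‖)⁻¹ • w N with hv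
  have hvs : ∀ N, v N ∈ Metric.sphere (0 : EuclideanSpace ℝ (Fin d)) 1 := fun N => by
    simp [hv, norm_smul, (hwpos N).ne']
  obtain ⟨u, hu, φ, hφ, hlim⟩ := (isCompact_sphere _ _).tendsto_subseq hvs
  have huV : u ∈ (LinearMap.ker (toEuclideanLin X))ᗮ :=
    (Submodule.isClosed_orthogonal _).mem_of_tendsto hlim
      (Eventually.of_forall fun N => Submodule.smul_mem _ _ (hw _))
  have hXu : toEuclideanLin X u ≠ 0 := fun h0 => by
    have : inner ℝ u u = (0 : ℝ) := (Submodule.mem_orthogonal _ _).1 huV u h0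
    rw [inner_self_eq_zero] at this
    simp [this] at hu
  have hinv : Tendsto (fun N => (‖w (φ N)‖)⁻¹) atTop (𝓝 0) := by
    refine tendsto_inv_atTop_zero.comp (tendsto_atTop_mono (fun N => ?_)
      tendsto_natCast_atTop_atTop)
    have h1 : (N : ℝ) ≤ φ N := by exact_mod_cast hφ.le_apply
    linarith [hnorm (φ N)]
  have hterm : ∀ i, toEuclideanLin X u i ≠ 0 →
      ∀ᶠ N in atTop, ((‖w (φ N)‖)⁻¹ * Y i - toEuclideanLin X (v (φ N)) i)
        * toEuclideanLin X u i < 0 := by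
    intro i hi
    have hc := continuous_toEuclideanLin_coord X i
    have ht : Tendsto (fun N => ((‖w (φ N)‖)⁻¹ * Y i - toEuclideanLin X (v (φ N)) i)
        * toEuclideanLin X u i) atTop (𝓝 ((0 * Y i - toEuclideanLin X u i)
        * toEuclideanLin X u i)) :=
      ((hinv.mul_const _).sub ((hc.tendsto u).comp hlim)).mul_const _
    -- The limit is -(Xu)ᵢ² < 0. Only signs matter from here on, so the positive weights may
    -- degenerate along the sequence.
    refine ht.eventually_lt_const ?_
    have := mul_self_pos.2 hi
    nlinarith
  have hall : ∀ᶠ N in atTop, ∀ i, toEuclideanLin X u i ≠ 0 →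
      ((‖w (φ N)‖)⁻¹ * Y i - toEuclideanLin X (v (φ N)) i) * toEuclideanLin X u i < 0 := by
    rw [eventually_all]
    intro i
    by_cases hi : toEuclideanLin X u i = 0
    · exact Eventually.of_forall fun _ h => absurd hi h
    · exact (hterm i hi).mono fun _ h _ => h
  obtain ⟨N, hN⟩ := hall.exists
  have hsum : ∑ i, m (φ N) i * (((‖w (φ N)‖)⁻¹ * Y i - toEuclideanLin X (v (φ N)) i)
      * toEuclideanLin X u i) = 0 := by
    have h0 := inner_gradVec X (fun i => m (φ N) i * (Y - toEuclideanLin X (w (φ N))) i) u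
    rw [hgrad, inner_zero_left] at h0
    have h1 : ∑ i, m (φ N) i * (((‖w (φ N)‖)⁻¹ * Y i - toEuclideanLin X (v (φ N)) i)
      * toEuclideanLin X u i) = (‖w (φ N)‖)⁻¹ *
        ∑ i, m (φ N) i * (Y - toEuclideanLin X (w (φ N))) i * toEuclideanLin X u i := by
      rw [Finset.mul_sum]
      refine Finset.sum_congr rfl fun i _ => ?_
      simp only [hv, map_smul, PiLp.smul_apply, PiLp.sub_apply, smul_eq_mul]
      ring
    rw [h1, ← h0, mul_zero]
  obtain ⟨i, hi⟩ : ∃ i, toEuclideanLin X u i ≠ 0 := by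
    by_contra! h
    exact hXu (by ext i; simpa using h i)
  have hneg : ∑ i, m (φ N) i * (((‖w (φ N)‖)⁻¹ * Y i - toEuclideanLin X (v (φ N)) i)
      * toEuclideanLin X u i) < 0 := by
    refine Finset.sum_neg' (fun j _ => ?_) ⟨i, Finset.mem_univ i,
      mul_neg_of_pos_of_neg (hm _ i) (hN i hi)⟩
    by_cases hj : toEuclideanLin X u j = 0
    · simp [hj]
    · exact (mul_neg_of_pos_of_neg (hm _ j) (hN j hj)).le
  exact hneg.ne hsum

/-- The row norms of `X`, weighted by the squared residuals of a positively weighted least squares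
problem, stay below `d ‖XᵀX‖ ‖r‖²` by a factor that does not depend on the weights. -/
theorem exists_sum_row_norm_mul_residual_sq_le (X : Matrix (Fin n) (Fin d) ℝ) :
    ∃ θ : ℝ, 0 ≤ θ ∧ θ < 1 ∧ ∀ (m : Fin n → ℝ) (r : EuclideanSpace ℝ (Fin n)), (∀ i, 0 < m i) →
      gradVec X (fun i => m i * r i) = 0 →
      ∑ i, r i ^ 2 * (X * Xᵀ) i i ≤ θ * (d * ‖Xᵀ * X‖ * ‖r‖ ^ 2) := by
  rcases Nat.lt_trichotomy d 1 with hd | hd | hd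
  · obtain rfl : d = 0 := by omega
    exact ⟨0, le_rfl, one_pos, fun m r _ _ => by simp [mul_apply]⟩
  · subst hd
    have hK : ∀ i, (X * Xᵀ) i i = X i 0 ^ 2 := fun i => by simp [mul_apply, sq]
    have hle : ∀ i j, i ≠ j → X i 0 ^ 2 + X j 0 ^ 2 ≤ ‖Xᵀ * X‖ := by
      intro i j hij
      have h := sum_toEuclideanLin_sq_le X (EuclideanSpace.single 0 1)
      have h1 : ∀ k, toEuclideanLin X (EuclideanSpace.single 0 1) k = X k 0 := fun k => by
        simp [toLpLin_apply]
      simp only [h1, PiLp.norm_single, norm_one, one_pow, mul_one] at h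
      exact (Finset.add_le_sum (fun k _ => sq_nonneg (X k 0)) (Finset.mem_univ i)
        (Finset.mem_univ j) hij).trans h
    -- For d = 1, ‖XᵀX‖ is the sum of the squared entries. An entry can exhaust it only when all
    -- others vanish, and then the normal equations make the residual zero at that entry. As there
    -- are finitely many indices, one θ < 1 serves all the others.
    have hev : ∀ᶠ θ : ℝ in 𝓝[<] 1, ∀ i j, i ≠ j → X j 0 ≠ 0 →
        X i 0 ^ 2 ≤ θ * ‖Xᵀ * X‖ := by
      simp only [eventually_all]
      intro i j hij hj
      have ht : Tendsto (fun θ : ℝ => θ * ‖Xᵀ * X‖) (𝓝[<] 1) (𝓝 (1 * ‖Xᵀ * X‖)) :=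
        (tendsto_id.mul_const _).mono_left nhdsWithin_le_nhds
      have hlt : X i 0 ^ 2 < 1 * ‖Xᵀ * X‖ := by
        have := hle i j hij
        have := sq_pos_of_ne_zero hj
        linarith
      exact (ht.eventually_const_lt hlt).mono fun _ h => h.le
    have hpos : ∀ᶠ θ : ℝ in 𝓝[<] 1, 0 ≤ θ :=
      nhdsWithin_le_nhds (eventually_ge_nhds one_pos)
    obtain ⟨θ, ⟨hθ, hθ0⟩, hθ1⟩ := ((hev.and hpos).and self_mem_nhdsWithin).exists
    refine ⟨θ, hθ0, hθ1, fun m r hm hr => ?_⟩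
    rw [EuclideanSpace.real_norm_sq_eq, Nat.cast_one, one_mul, Finset.mul_sum, Finset.mul_sum]
    refine Finset.sum_le_sum fun i _ => ?_
    rw [hK]
    by_cases hi : X i 0 * r i = 0
    · have : r i ^ 2 * X i 0 ^ 2 = 0 := by rw [← mul_pow, mul_comm, hi]; ring
      rw [this]
      positivity
    · obtain ⟨j, hji, hj⟩ : ∃ j, j ≠ i ∧ X j 0 ≠ 0 := by
        by_contra! h
        have h0 : gradVec X (fun i => m i * r i) 0 = 0 := by rw [hr]; rfl
        rw [gradVec_apply, Finset.sum_eq_single i (fun j _ hj => by rw [h j hj, zero_mul])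
          (fun h => absurd (Finset.mem_univ i) h)] at h0
        apply hi
        have := (hm i).ne'
        have h2 : m i * (X i 0 * r i) = 0 := by linarith
        exact (mul_eq_zero.1 h2).resolve_left this
      nlinarith [hθ i j hji.symm hj, sq_nonneg (r i)]
  -- For d ≥ 2 the row bound without the factor d already gains a factor 1/d ≤ 1/2.
  · refine ⟨1 / 2, by norm_num, by norm_num, fun m r _ _ => ?_⟩
    have hd' : (2 : ℝ) ≤ d := by exact_mod_cast hd
    have hn : 0 ≤ ‖Xᵀ * X‖ * ‖r‖ ^ 2 := by positivity
    have h1 : ∑ i, r i ^ 2 * (X * Xᵀ) i i ≤ ‖Xᵀ * X‖ * ‖r‖ ^ 2 := by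
      rw [EuclideanSpace.real_norm_sq_eq, Finset.mul_sum]
      refine Finset.sum_le_sum fun i _ => ?_
      nlinarith [row_norm_sq_le X i, sq_nonneg (r i)]
    nlinarith

end WeightedLeastSquares

/-! ### First and second moments of one random step. -/

section Moments

variable {n d : ℕ}

/-- The law of one step from a point with law `μ`, with an independent weighting of law `ν`. -/
noncomputable def stepLaw (X : Matrix (Fin n) (Fin d) ℝ) (Y : EuclideanSpace ℝ (Fin n)) (α : ℝ)
    (ν : Measure (Fin n → ℝ)) (μ : Measure (EuclideanSpace ℝ (Fin d))) :
    Measure (EuclideanSpace ℝ (Fin d)) :=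
  (ν.prod μ).map fun p => wgdStep X Y α p.1 p.2

theorem continuous_wgdStep (X : Matrix (Fin n) (Fin d) ℝ) (Y : EuclideanSpace ℝ (Fin n)) (α : ℝ) :
    Continuous fun p : (Fin n → ℝ) × EuclideanSpace ℝ (Fin d) => wgdStep X Y α p.1 p.2 := by
  simp only [wgdStep_eq]
  refine continuous_snd.sub (((gradVec_continuous X).comp (continuous_pi fun i => ?_)).const_smul α)
  exact (((continuous_apply i).comp continuous_fst).pow 2).mul
    (((continuous_toEuclideanLin_coord X i).comp continuous_snd).sub continuous_const)

theorem wgdStep_sub_wgdStep (X : Matrix (Fin n) (Fin d) ℝ) (Y : EuclideanSpace ℝ (Fin n)) (α : ℝ)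
    (δ : Fin n → ℝ) (w w' : EuclideanSpace ℝ (Fin d)) :
    wgdStep X Y α δ w - wgdStep X Y α δ w'
      = (w - w') - α • gradVec X (fun i => δ i ^ 2 * toEuclideanLin X (w - w') i) := by
  rw [wgdStep_eq, wgdStep_eq, sub_sub_sub_comm, ← smul_sub, ← map_sub]
  congr 3
  ext i
  simp only [Pi.sub_apply, map_sub, PiLp.sub_apply]
  ring

theorem wgdStep_sub (X : Matrix (Fin n) (Fin d) ℝ) (Y : EuclideanSpace ℝ (Fin n)) (α : ℝ)
    (δ : Fin n → ℝ) (w v : EuclideanSpace ℝ (Fin d)) :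
    wgdStep X Y α δ w - v = (w - v) - α • gradVec X
      (fun i => δ i ^ 2 * (toEuclideanLin X (w - v) i - (Y - toEuclideanLin X v) i)) := by
  rw [wgdStep_eq, sub_right_comm]
  congr 3
  ext i
  simp only [map_sub, PiLp.sub_apply]
  ring

theorem wgdStep_mem_orthogonal_ker {X : Matrix (Fin n) (Fin d) ℝ} (Y : EuclideanSpace ℝ (Fin n))
    (α : ℝ) (δ : Fin n → ℝ) {w : EuclideanSpace ℝ (Fin d)}
    (hw : w ∈ (LinearMap.ker (toEuclideanLin X))ᗮ) :
    wgdStep X Y α δ w ∈ (LinearMap.ker (toEuclideanLin X))ᗮ := by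
  rw [wgdStep_eq]
  exact Submodule.sub_mem _ hw (Submodule.smul_mem _ _ (gradVec_mem_orthogonal_ker _ _))

theorem ofReal_norm_sq_eq_enorm_rpow {E : Type*} [NormedAddCommGroup E] (v : E) :
    ENNReal.ofReal (‖v‖ ^ 2) = ‖v‖ₑ ^ (2 : ℝ) := by
  rw [ENNReal.ofReal_pow (norm_nonneg v), ofReal_norm, ← ENNReal.rpow_natCast]
  norm_num

theorem ae_abs_apply_le {ν : Measure (Fin n → ℝ)} {τ : ℝ}
    (h : ∀ᵐ δ ∂ν, ‖(diagonal δ : Matrix (Fin n) (Fin n) ℝ)‖ ≤ τ) :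
    ∀ᵐ δ ∂ν, ∀ i, δ i ^ 2 ≤ τ ^ 2 := by
  filter_upwards [h] with δ hδ i
  rw [l2_opNorm_diagonal] at hδ
  have h1 : |δ i| ≤ τ := (norm_le_pi_norm δ i).trans hδ
  exact sq_le_sq.2 (h1.trans (le_abs_self τ))

variable {ν : Measure (Fin n → ℝ)} {τ : ℝ}

theorem memLp_sq_apply [IsProbabilityMeasure ν]
    (hb : ∀ᵐ δ ∂ν, ∀ i, δ i ^ 2 ≤ τ ^ 2) (i : Fin n) (p : ℝ≥0∞) :
    MemLp (fun δ : Fin n → ℝ => δ i ^ 2) p ν := by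
  refine MemLp.of_bound ((measurable_pi_apply i).pow_const 2).aestronglyMeasurable (τ ^ 2) ?_
  filter_upwards [hb] with δ hδ
  rw [Real.norm_of_nonneg (sq_nonneg _)]
  exact hδ i

theorem integrable_sq_apply [IsProbabilityMeasure ν]
    (hb : ∀ᵐ δ ∂ν, ∀ i, δ i ^ 2 ≤ τ ^ 2) (i : Fin n) :
    Integrable (fun δ : Fin n → ℝ => δ i ^ 2) ν :=
  (memLp_sq_apply hb i 1).integrable le_rfl

/-- Contraction in mean square of the homogeneous part of a step. -/
theorem lintegral_step_sq_le [IsProbabilityMeasure ν]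
    (hb : ∀ᵐ δ ∂ν, ∀ i, δ i ^ 2 ≤ τ ^ 2) (hM : IsUnit (secondMoment ν))
    (X : Matrix (Fin n) (Fin d) ℝ) {α : ℝ} (hα : 0 < α) (hατ : α * τ ^ 2 * ‖Xᵀ * X‖ < 2)
    {u : EuclideanSpace ℝ (Fin d)} (hu : u ∈ (LinearMap.ker (toEuclideanLin X))ᗮ) :
    ∫⁻ δ, ‖u - α • gradVec X (fun i => δ i ^ 2 * toEuclideanLin X u i)‖ₑ ^ (2 : ℝ) ∂ν
      ≤ ENNReal.ofReal (Real.exp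
          (-(α * (2 - α * τ ^ 2 * ‖Xᵀ * X‖) * sigmaMinPos (weightedGram X ν))))
        * ‖u‖ₑ ^ (2 : ℝ) := by
  set κ := 2 - α * τ ^ 2 * ‖Xᵀ * X‖ with hκ
  have hκ0 : 0 < κ := by linarith
  set p := toEuclideanLin X u with hp
  have hint : Integrable (fun δ : Fin n → ℝ => ‖u‖ ^ 2 - α * κ * ∑ i, δ i ^ 2 * p i ^ 2) ν :=
    (integrable_const _).sub ((integrable_finsetSum _ fun i _ =>
      (integrable_sq_apply hb i).mul_const _).const_mul _)
  have hle : ∀ᵐ δ ∂ν, ‖u - α • gradVec X (fun i => δ i ^ 2 * p i)‖ ^ 2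
      ≤ ‖u‖ ^ 2 - α * κ * ∑ i, δ i ^ 2 * p i ^ 2 := by
    filter_upwards [hb] with δ hδ
    have h1 : inner ℝ u (gradVec X (fun i => δ i ^ 2 * p i)) = ∑ i, δ i ^ 2 * p i ^ 2 := by
      rw [real_inner_comm, inner_gradVec]
      exact Finset.sum_congr rfl fun i _ => by ring
    -- From δᵢ⁴ ≤ τ²δᵢ², the quadratic term of the square is a multiple of the cross term; the two
    -- combine to the coefficient -ακ.
    have h2 : ‖gradVec X (fun i => δ i ^ 2 * p i)‖ ^ 2
        ≤ ‖Xᵀ * X‖ * (τ ^ 2 * ∑ i, δ i ^ 2 * p i ^ 2) := by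
      refine (norm_gradVec_sq_le X _).trans (mul_le_mul_of_nonneg_left ?_ (norm_nonneg _))
      rw [Finset.mul_sum]
      refine Finset.sum_le_sum fun i _ => ?_
      have := mul_le_mul_of_nonneg_right (hδ i) (mul_nonneg (sq_nonneg (δ i)) (sq_nonneg (p i)))
      nlinarith
    rw [norm_sub_sq_real, inner_smul_right, h1, norm_smul, mul_pow, Real.norm_eq_abs, sq_abs]
    nlinarith [mul_le_mul_of_nonneg_left h2 (sq_nonneg α)]
  have hσ : sigmaMinPos (weightedGram X ν) * ‖u‖ ^ 2 ≤ ∑ i, (∫ δ, δ i ^ 2 ∂ν) * p i ^ 2 := by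
    have h := (sigmaMinPos_mul_norm_sq_le (isPositive_weightedGram X ν)
      (mem_orthogonal_ker_weightedGram hM hu)).1
    rw [inner_weightedGram_apply] at h
    simpa only [sq] using h
  calc ∫⁻ δ, ‖u - α • gradVec X (fun i => δ i ^ 2 * p i)‖ₑ ^ (2 : ℝ) ∂ν
      ≤ ∫⁻ δ, ENNReal.ofReal (‖u‖ ^ 2 - α * κ * ∑ i, δ i ^ 2 * p i ^ 2) ∂ν := by
        refine lintegral_mono_ae ?_
        filter_upwards [hle] with δ hδ
        rw [← ofReal_norm_sq_eq_enorm_rpow]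
        exact ENNReal.ofReal_le_ofReal hδ
    _ = ENNReal.ofReal (∫ δ, ‖u‖ ^ 2 - α * κ * ∑ i, δ i ^ 2 * p i ^ 2 ∂ν) := by
        rw [ofReal_integral_eq_lintegral_ofReal hint]
        filter_upwards [hle] with δ hδ
        exact (sq_nonneg _).trans hδ
    _ ≤ ENNReal.ofReal (Real.exp (-(α * κ * sigmaMinPos (weightedGram X ν))) * ‖u‖ ^ 2) := by
        refine ENNReal.ofReal_le_ofReal ?_
        rw [integral_sub (integrable_const _) ((integrable_finsetSum _ fun i _ =>
          (integrable_sq_apply hb i).mul_const _).const_mul _), integral_const_mul,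
          integral_finsetSum _ fun i _ => (integrable_sq_apply hb i).mul_const _]
        simp only [integral_mul_const, integral_const, probReal_univ, one_smul]
        have h1 := Real.add_one_le_exp (-(α * κ * sigmaMinPos (weightedGram X ν)))
        have h2 := mul_le_mul_of_nonneg_left hσ (mul_pos hα hκ0).le
        nlinarith [mul_le_mul_of_nonneg_right h1 (sq_nonneg ‖u‖)]
    _ = _ := by
        rw [ENNReal.ofReal_mul (Real.exp_pos _).le, ofReal_norm_sq_eq_enorm_rpow]

/-- The quadratic form `q ↦ E ‖Xᵀ (D² - M₂) q‖²`. -/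
noncomputable def noiseForm (X : Matrix (Fin n) (Fin d) ℝ) (ν : Measure (Fin n → ℝ))
    (q : Fin n → ℝ) : ℝ :=
  ∑ i, ∑ j, (X * Xᵀ) i j * (q i * q j) * covSq ν i j

theorem sum_mul_mul_le_norm (A : Matrix (Fin n) (Fin n) ℝ) (v : Fin n → ℝ) :
    ∑ i, ∑ j, v i * v j * A i j ≤ ‖A‖ * ∑ i, v i ^ 2 := by
  have h1 : ∑ i, ∑ j, v i * v j * A i j
      = inner ℝ (WithLp.toLp 2 v) (toEuclideanLin A (WithLp.toLp 2 v)) := by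
    simp only [PiLp.inner_apply, toLpLin_apply, mulVec, dotProduct, RCLike.inner_apply,
      conj_trivial, Finset.sum_mul]
    exact Finset.sum_congr rfl fun i _ => Finset.sum_congr rfl fun j _ => by ring
  have h2 : ∑ i, v i ^ 2 = ‖(WithLp.toLp 2 v : EuclideanSpace ℝ (Fin n))‖ ^ 2 := by
    rw [EuclideanSpace.real_norm_sq_eq]
  rw [h1, h2]
  refine (real_inner_le_norm _ _).trans ?_
  have := norm_toEuclideanLin_le A (WithLp.toLp 2 v)
  nlinarith [norm_nonneg (WithLp.toLp 2 v : EuclideanSpace ℝ (Fin n))]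

/-- The entries of XXᵀ are sums over the columns of X, so the form splits into ∑ₗ zₗᵀ Σ_D zₗ with zₗ
= (Xᵢₗqᵢ)ᵢ. Each summand is at most ‖Σ_D‖‖zₗ‖². -/
theorem noiseForm_le (X : Matrix (Fin n) (Fin d) ℝ) (q : Fin n → ℝ) :
    noiseForm X ν q ≤ ‖covSq ν‖ * ∑ i, q i ^ 2 * (X * Xᵀ) i i := by
  have h1 : noiseForm X ν q
      = ∑ l, ∑ i, ∑ j, (X i l * q i) * (X j l * q j) * covSq ν i j := by
    rw [noiseForm, Finset.sum_comm]
    simp only [mul_apply, transpose_apply, Finset.sum_mul]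
    rw [Finset.sum_comm]
    conv_rhs => rw [Finset.sum_comm]
    refine Finset.sum_congr rfl fun i _ => ?_
    conv_rhs => rw [Finset.sum_comm]
    exact Finset.sum_congr rfl fun j _ => Finset.sum_congr rfl fun l _ => by ring
  have h2 : ∑ i, q i ^ 2 * (X * Xᵀ) i i = ∑ l, ∑ i, (X i l * q i) ^ 2 := by
    rw [Finset.sum_comm]
    refine Finset.sum_congr rfl fun i _ => ?_
    rw [mul_apply, Finset.mul_sum]
    exact Finset.sum_congr rfl fun l _ => by rw [transpose_apply]; ring
  rw [h1, h2, Finset.mul_sum]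
  exact Finset.sum_le_sum fun l _ => sum_mul_mul_le_norm _ _

/-- The row norms and ‖Xu‖² each contribute a factor ‖X‖²: this is the ‖X‖⁴ of the step-size
condition. -/
theorem noiseForm_toEuclideanLin_le (X : Matrix (Fin n) (Fin d) ℝ)
    (u : EuclideanSpace ℝ (Fin d)) :
    noiseForm X ν (toEuclideanLin X u) ≤ ‖X‖ ^ 4 * ‖covSq ν‖ * ‖u‖ ^ 2 := by
  have h1 : ∑ i, toEuclideanLin X u i ^ 2 * (X * Xᵀ) i i
      ≤ ‖Xᵀ * X‖ * ∑ i, toEuclideanLin X u i ^ 2 := by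
    rw [Finset.mul_sum]
    refine Finset.sum_le_sum fun i _ => ?_
    nlinarith [row_norm_sq_le X i, sq_nonneg (toEuclideanLin X u i)]
  have h2 := mul_le_mul_of_nonneg_left (sum_toEuclideanLin_sq_le X u) (norm_nonneg (Xᵀ * X))
  calc _ ≤ _ := noiseForm_le X _
    _ ≤ ‖covSq ν‖ * (‖Xᵀ * X‖ * (‖Xᵀ * X‖ * ‖u‖ ^ 2)) :=
        mul_le_mul_of_nonneg_left (h1.trans h2) (norm_nonneg _)
    _ = _ := by rw [norm_transpose_mul_self]; ring

/-- Only linearity of the cross term matters, because it integrates to zero against a law with mean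
ŵ; the vector c is therefore left unspecified. -/
theorem noiseForm_sub (X : Matrix (Fin n) (Fin d) ℝ) (r : Fin n → ℝ) :
    ∃ c : EuclideanSpace ℝ (Fin d), ∀ u : EuclideanSpace ℝ (Fin d),
      noiseForm X ν (fun i => toEuclideanLin X u i - r i)
        = noiseForm X ν (toEuclideanLin X u) + inner ℝ c u + noiseForm X ν r := by
  refine ⟨gradVec X (fun i => -∑ j, r j * ((X * Xᵀ) i j * covSq ν i j
    + (X * Xᵀ) j i * covSq ν j i)), fun u => ?_⟩
  rw [inner_gradVec]
  simp only [mul_add, Finset.sum_add_distrib, neg_mul, Finset.sum_neg_distrib, add_mul,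
    Finset.sum_mul]
  have h : ∑ i, ∑ j, r j * ((X * Xᵀ) j i * covSq ν j i) * toEuclideanLin X u i
      = ∑ i, ∑ j, r i * ((X * Xᵀ) i j * covSq ν i j) * toEuclideanLin X u j := Finset.sum_comm
  rw [h, ← sub_eq_zero]
  simp only [noiseForm, ← Finset.sum_add_distrib, ← Finset.sum_sub_distrib, neg_add,
    ← Finset.sum_neg_distrib]
  exact Finset.sum_eq_zero fun i _ => Finset.sum_eq_zero fun j _ => by ring

theorem integral_centered_sq [IsProbabilityMeasure ν]
    (hb : ∀ᵐ δ ∂ν, ∀ i, δ i ^ 2 ≤ τ ^ 2) (i : Fin n) :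
    Integrable (fun δ : Fin n → ℝ => δ i ^ 2 - ∫ x, x i ^ 2 ∂ν) ν ∧
      ∫ δ : Fin n → ℝ, (δ i ^ 2 - ∫ x, x i ^ 2 ∂ν) ∂ν = 0 := by
  refine ⟨(integrable_sq_apply hb i).sub (integrable_const _), ?_⟩
  rw [integral_sub (integrable_sq_apply hb i) (integrable_const _)]
  simp

/-- The normal equations `hr` remove the drift Xᵀ M₂ r, leaving the deterministic gradient step and
a noise term that is centered for fixed u. -/
theorem step_eq_mean_add_noise {X : Matrix (Fin n) (Fin d) ℝ} {r : Fin n → ℝ}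
    (hr : gradVec X (fun i => (∫ x, x i ^ 2 ∂ν) * r i) = 0) (α : ℝ)
    (u : EuclideanSpace ℝ (Fin d)) (δ : Fin n → ℝ) :
    u - α • gradVec X (fun i => δ i ^ 2 * (toEuclideanLin X u i - r i))
      = (u - α • toEuclideanLin (weightedGram X ν) u) - α • gradVec X
        (fun i => (δ i ^ 2 - ∫ x, x i ^ 2 ∂ν) * (toEuclideanLin X u i - r i)) := by
  have h : gradVec X (fun i => δ i ^ 2 * (toEuclideanLin X u i - r i))
      = toEuclideanLin (weightedGram X ν) u - gradVec X (fun i => (∫ x, x i ^ 2 ∂ν) * r i)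
        + gradVec X (fun i => (δ i ^ 2 - ∫ x, x i ^ 2 ∂ν) * (toEuclideanLin X u i - r i)) := by
    rw [weightedGram_apply, ← map_sub, ← map_add]
    congr 1
    ext i
    simp only [Pi.add_apply, Pi.sub_apply]
    ring
  rw [h, hr, sub_zero, smul_add, sub_sub]

theorem integral_inner_step [IsProbabilityMeasure ν]
    (hb : ∀ᵐ δ ∂ν, ∀ i, δ i ^ 2 ≤ τ ^ 2)
    {X : Matrix (Fin n) (Fin d) ℝ} {r : Fin n → ℝ}
    (hr : gradVec X (fun i => (∫ x, x i ^ 2 ∂ν) * r i) = 0) (α : ℝ)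
    (u c : EuclideanSpace ℝ (Fin d)) :
    ∫ δ, inner ℝ (u - α • gradVec X (fun i => δ i ^ 2 * (toEuclideanLin X u i - r i))) c ∂ν
      = inner ℝ (u - α • toEuclideanLin (weightedGram X ν) u) c := by
  simp only [step_eq_mean_add_noise hr, inner_sub_left (u - _), inner_smul_left _ _ α,
    inner_gradVec, mul_assoc]
  rw [integral_sub (integrable_const _) ((integrable_finsetSum _ fun i _ =>
    (integral_centered_sq hb i).1.mul_const _).const_mul _), integral_const_mul,
    integral_finsetSum _ fun i _ => (integral_centered_sq hb i).1.mul_const _]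
  simp [integral_mul_const, (integral_centered_sq hb _).2]

/-- The exact mean square of a step, as a function of the starting point. -/
theorem integral_step_sq [IsProbabilityMeasure ν]
    (hb : ∀ᵐ δ ∂ν, ∀ i, δ i ^ 2 ≤ τ ^ 2)
    {X : Matrix (Fin n) (Fin d) ℝ} {r : Fin n → ℝ}
    (hr : gradVec X (fun i => (∫ x, x i ^ 2 ∂ν) * r i) = 0) (α : ℝ)
    (u : EuclideanSpace ℝ (Fin d)) :
    Integrable (fun δ : Fin n → ℝ =>
        ‖u - α • gradVec X (fun i => δ i ^ 2 * (toEuclideanLin X u i - r i))‖ ^ 2) ν ∧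
      ∫ δ, ‖u - α • gradVec X (fun i => δ i ^ 2 * (toEuclideanLin X u i - r i))‖ ^ 2 ∂ν
        = ‖u - α • toEuclideanLin (weightedGram X ν) u‖ ^ 2
          + α ^ 2 * noiseForm X ν (fun i => toEuclideanLin X u i - r i) := by
  set a := u - α • toEuclideanLin (weightedGram X ν) u with ha
  set q : Fin n → ℝ := fun i => toEuclideanLin X u i - r i with hq
  set z : Fin n → (Fin n → ℝ) → ℝ := fun i δ => δ i ^ 2 - ∫ x, x i ^ 2 ∂ν with hz
  have hzz : ∀ i j, Integrable (fun δ => z i δ * z j δ) ν := fun i j =>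
    ((memLp_sq_apply hb i 2).sub (memLp_const _)).integrable_mul
      ((memLp_sq_apply hb j 2).sub (memLp_const _))
  have hcov : ∀ i j, ∫ δ, z i δ * z j δ ∂ν = covSq ν i j := fun i j => rfl
  -- In the expanded square the terms linear in z have mean zero, and the products zᵢzⱼ integrate to
  -- the entries of Σ_D.
  have hexp : ∀ δ : Fin n → ℝ, ‖u - α • gradVec X (fun i => δ i ^ 2 * q i)‖ ^ 2
      = ‖a‖ ^ 2 - 2 * α * (∑ i, z i δ * (q i * toEuclideanLin X a i))
        + α ^ 2 * ∑ i, ∑ j, z i δ * z j δ * ((X * Xᵀ) i j * (q i * q j)) := by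
    intro δ
    rw [step_eq_mean_add_noise hr, ← ha, norm_sub_sq_real, inner_smul_right, real_inner_comm,
      inner_gradVec, norm_smul, mul_pow, norm_gradVec_sq, Real.norm_eq_abs, sq_abs]
    congr 2
    · rw [mul_assoc]
      simp only [hz, hq, mul_assoc]
    · refine Finset.sum_congr rfl fun i _ => Finset.sum_congr rfl fun j _ => ?_
      simp only [hz, hq]
      ring
  have hi1 : Integrable (fun δ => 2 * α * (∑ i, z i δ * (q i * toEuclideanLin X a i))) ν :=
    (integrable_finsetSum _ fun i _ => (integral_centered_sq hb i).1.mul_const _).const_mul _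
  have hi2 : Integrable
      (fun δ => α ^ 2 * ∑ i, ∑ j, z i δ * z j δ * ((X * Xᵀ) i j * (q i * q j))) ν :=
    (integrable_finsetSum _ fun i _ => integrable_finsetSum _ fun j _ =>
      (hzz i j).mul_const _).const_mul _
  have hfun : (fun δ : Fin n → ℝ =>
      ‖u - α • gradVec X (fun i => δ i ^ 2 * (toEuclideanLin X u i - r i))‖ ^ 2)
      = fun δ => ‖a‖ ^ 2 - 2 * α * (∑ i, z i δ * (q i * toEuclideanLin X a i))
        + α ^ 2 * ∑ i, ∑ j, z i δ * z j δ * ((X * Xᵀ) i j * (q i * q j)) := funext hexp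
  rw [hfun]
  refine ⟨((integrable_const _).sub hi1).add hi2, ?_⟩
  rw [integral_add (f := fun δ => _ - _) ((integrable_const _).sub hi1) hi2, integral_sub (integrable_const _) hi1,
    integral_const_mul, integral_const_mul,
    integral_finsetSum _ fun i _ => (integral_centered_sq hb i).1.mul_const _,
    integral_finsetSum _ fun i _ => integrable_finsetSum _ fun j _ => (hzz i j).mul_const _]
  have h1 : ∀ i, ∫ δ, z i δ * (q i * toEuclideanLin X a i) ∂ν = 0 := fun i => by
    rw [integral_mul_const, (integral_centered_sq hb i).2, zero_mul]
  have h2 : ∀ i, ∫ δ, ∑ j, z i δ * z j δ * ((X * Xᵀ) i j * (q i * q j)) ∂ν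
      = ∑ j, (X * Xᵀ) i j * (q i * q j) * covSq ν i j := fun i => by
    rw [integral_finsetSum _ fun j _ => (hzz i j).mul_const _]
    refine Finset.sum_congr rfl fun j _ => ?_
    rw [integral_mul_const, hcov, mul_comm]
  rw [Finset.sum_congr rfl fun i _ => h1 i, Finset.sum_congr rfl fun i _ => h2 i]
  simp [noiseForm]

end Moments

/-! ### Propagation of the mean and the mean square distance to ŵ. -/

section Laws

variable {n d : ℕ} {ν : Measure (Fin n → ℝ)} {τ α : ℝ} {X : Matrix (Fin n) (Fin d) ℝ}
  {Y : EuclideanSpace ℝ (Fin n)}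

/-- Division by zero yields 0, so α > 0 forces a positive denominator and then σ > 0. This excludes
a vanishing Gram matrix, for which `sigmaMinPos` is `sInf ∅ = 0`. -/
theorem step_size_bound {σ s : ℝ} (hα : 0 < α) (hs : 0 ≤ s) (h : α < σ / (σ ^ 2 + s)) :
    0 < σ ∧ α * (σ ^ 2 + s) < σ := by
  have hq : 0 < σ / (σ ^ 2 + s) := hα.trans h
  have hden : 0 < σ ^ 2 + s := lt_of_le_of_ne (by positivity) fun h0 => by simp [← h0] at hq
  have h1 := (lt_div_iff₀ hden).1 h
  exact ⟨(mul_pos hα hden).trans h1, h1⟩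

theorem isProbabilityMeasure_stepLaw [IsProbabilityMeasure ν]
    (μ : Measure (EuclideanSpace ℝ (Fin d))) [IsProbabilityMeasure μ] :
    IsProbabilityMeasure (stepLaw X Y α ν μ) :=
  Measure.isProbabilityMeasure_map (continuous_wgdStep X Y α).measurable.aemeasurable

/-- A square-integrable law on `ker(X)ᗮ` with mean `v`. -/
structure IsCenteredLaw (X : Matrix (Fin n) (Fin d) ℝ) (v : EuclideanSpace ℝ (Fin d))
    (μ : Measure (EuclideanSpace ℝ (Fin d))) : Prop where
  prob : IsProbabilityMeasure μ
  memLp : MemLp (fun w => w - v) 2 μ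
  mem : ∀ᵐ w ∂μ, w ∈ (LinearMap.ker (toEuclideanLin X))ᗮ
  mean : ∀ c : EuclideanSpace ℝ (Fin d), ∫ w, inner ℝ (w - v) c ∂μ = 0

theorem isCenteredLaw_dirac {v : EuclideanSpace ℝ (Fin d)}
    (hv : v ∈ (LinearMap.ker (toEuclideanLin X))ᗮ) : IsCenteredLaw X v (Measure.dirac v) where
  prob := inferInstance
  memLp := by
    refine (memLp_const (0 : EuclideanSpace ℝ (Fin d))).ae_eq ?_
    rw [Filter.EventuallyEq, ae_dirac_eq]
    simp
  mem := by
    rw [ae_dirac_eq]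
    exact hv
  mean := fun c => by simp

theorem ae_mem_stepLaw [IsProbabilityMeasure ν] {μ : Measure (EuclideanSpace ℝ (Fin d))}
    [IsProbabilityMeasure μ] (h : ∀ᵐ w ∂μ, w ∈ (LinearMap.ker (toEuclideanLin X))ᗮ) :
    ∀ᵐ w ∂(stepLaw X Y α ν μ), w ∈ (LinearMap.ker (toEuclideanLin X))ᗮ := by
  rw [stepLaw, ae_map_iff (p := (· ∈ (LinearMap.ker (toEuclideanLin X))ᗮ))
    (continuous_wgdStep X Y α).measurable.aemeasurable
    (Submodule.isClosed_orthogonal _).measurableSet]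
  filter_upwards [Measure.quasiMeasurePreserving_snd.ae h] with p hp
  exact wgdStep_mem_orthogonal_ker Y α p.1 hp

/-- A step preserves the mean `ŵ`, and it contracts the mean square distance to `ŵ` up to the
noise `α² E ‖Xᵀ (D² - M₂) (Y - X ŵ)‖²`. -/
theorem IsCenteredLaw.step [IsProbabilityMeasure ν] {μ : Measure (EuclideanSpace ℝ (Fin d))}
    (hb : ∀ᵐ δ ∂ν, ∀ i, δ i ^ 2 ≤ τ ^ 2) (hM : IsUnit (secondMoment ν)) (hα : 0 < α)
    (hα1 : α * ‖weightedGram X ν‖ < 1)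
    (hα2 : α < sigmaMinPos (weightedGram X ν) /
      (sigmaMinPos (weightedGram X ν) ^ 2 + ‖X‖ ^ 4 * ‖covSq ν‖))
    (hμ : IsCenteredLaw X (wHat X Y ν) μ) :
    IsCenteredLaw X (wHat X Y ν) (stepLaw X Y α ν μ) ∧
      ∫ w, ‖w - wHat X Y ν‖ ^ 2 ∂(stepLaw X Y α ν μ)
        ≤ (1 - α * sigmaMinPos (weightedGram X ν)) * ∫ w, ‖w - wHat X Y ν‖ ^ 2 ∂μ
          + α ^ 2 * noiseForm X ν (Y - toEuclideanLin X (wHat X Y ν)).ofLp := by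
  obtain ⟨hprob, hLp, hmem, hmean⟩ := hμ
  set v := wHat X Y ν with hv
  set σ := sigmaMinPos (weightedGram X ν) with hσ
  set r : Fin n → ℝ := (Y - toEuclideanLin X v).ofLp with hr
  have hrn : gradVec X (fun i => (∫ x, x i ^ 2 ∂ν) * r i) = 0 := gradVec_residual_wHat X Y ν
  obtain ⟨-, hα3⟩ := step_size_bound hα (by positivity) hα2
  have hmeas : Measurable fun p : (Fin n → ℝ) × EuclideanSpace ℝ (Fin d) =>
      wgdStep X Y α p.1 p.2 := (continuous_wgdStep X Y α).measurable
  have hcont : Continuous fun w : EuclideanSpace ℝ (Fin d) => ‖w - v‖ ^ 2 := by fun_prop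
  obtain ⟨c, hc⟩ := noiseForm_sub (ν := ν) X r
  -- H dominates the mean square distance after a step from w; its linear part has μ-mean zero.
  set H : EuclideanSpace ℝ (Fin d) → ℝ := fun w => (1 - α * σ) * ‖w - v‖ ^ 2
    + α ^ 2 * (inner ℝ (w - v) c + noiseForm X ν r) with hH
  have hsq : Integrable (fun w => ‖w - v‖ ^ 2) μ := hLp.integrable_norm_pow two_ne_zero
  have hin : ∀ c : EuclideanSpace ℝ (Fin d), Integrable (fun w => inner ℝ (w - v) c) μ :=
    fun c => (hLp.integrable one_le_two).inner_const c
  have hHint : Integrable H μ := (hsq.const_mul _).add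
    (((hin c).add (integrable_const _)).const_mul _)
  have hHval : ∫ w, H w ∂μ = (1 - α * σ) * ∫ w, ‖w - v‖ ^ 2 ∂μ + α ^ 2 * noiseForm X ν r := by
    have h2 : ∫ w, α ^ 2 * (inner ℝ (w - v) c + noiseForm X ν r) ∂μ
        = α ^ 2 * noiseForm X ν r := by
      rw [integral_const_mul, integral_add (hin c) (integrable_const _), hmean]
      simp
    have h3 : Integrable (fun w => α ^ 2 * (inner ℝ (w - v) c + noiseForm X ν r)) μ :=
      ((hin c).add (integrable_const _)).const_mul _
    simp only [hH]
    rw [integral_add (hsq.const_mul _) h3, integral_const_mul, h2]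
  have hstep : ∀ᵐ w ∂μ, ∫⁻ δ, ENNReal.ofReal (‖wgdStep X Y α δ w - v‖ ^ 2) ∂ν
      ≤ ENNReal.ofReal (H w) ∧ 0 ≤ H w := by
    filter_upwards [hmem] with w hw
    have hu : w - v ∈ (LinearMap.ker (toEuclideanLin X))ᗮ :=
      Submodule.sub_mem _ hw (wHat_mem_orthogonal_ker X Y ν)
    obtain ⟨hi, he⟩ := integral_step_sq hb hrn α (w - v)
    have hle : ∫ δ, ‖(w - v) - α • gradVec X
        (fun i => δ i ^ 2 * (toEuclideanLin X (w - v) i - r i))‖ ^ 2 ∂ν ≤ H w := by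
      rw [he, hc]
      simp only [hH]
      have h1 := (sigmaMinPos_mul_norm_sq_le (isPositive_weightedGram X ν)
        (mem_orthogonal_ker_weightedGram hM hu)).2 α hα.le hα1.le
      have h2 := noiseForm_toEuclideanLin_le (ν := ν) X (w - v)
      rw [real_inner_comm c (w - v)]
      -- With s = ‖X‖⁴‖Σ_D‖, the inequality (1 - ασ)² + α²s ≤ 1 - ασ amounts to α(σ² + s) ≤ σ, which
      -- is the step-size condition.
      have h3 := mul_le_mul_of_nonneg_left h2 (sq_nonneg α)
      have h4 : ((1 - α * σ) ^ 2 + α ^ 2 * (‖X‖ ^ 4 * ‖covSq ν‖)) * ‖w - v‖ ^ 2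
          ≤ (1 - α * σ) * ‖w - v‖ ^ 2 := by
        refine mul_le_mul_of_nonneg_right ?_ (sq_nonneg _)
        nlinarith
      linarith
    simp only [wgdStep_sub, ← hr]
    rw [← ofReal_integral_eq_lintegral_ofReal hi (ae_of_all _ fun δ => sq_nonneg _)]
    exact ⟨ENNReal.ofReal_le_ofReal hle, (integral_nonneg fun δ => sq_nonneg _).trans hle⟩
  have hlin : ∫⁻ w, ENNReal.ofReal (‖w - v‖ ^ 2) ∂(stepLaw X Y α ν μ)
      ≤ ENNReal.ofReal (∫ w, H w ∂μ) := by
    rw [stepLaw, lintegral_map hcont.measurable.ennreal_ofReal hmeas,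
      lintegral_prod_symm' (fun p : (Fin n → ℝ) × EuclideanSpace ℝ (Fin d) =>
        ENNReal.ofReal (‖wgdStep X Y α p.1 p.2 - v‖ ^ 2))
        (hcont.measurable.comp hmeas).ennreal_ofReal,
      ofReal_integral_eq_lintegral_ofReal hHint (hstep.mono fun w h => h.2)]
    exact lintegral_mono_ae (hstep.mono fun w h => h.1)
  have hsq' : Integrable (fun w => ‖w - v‖ ^ 2) (stepLaw X Y α ν μ) := by
    rw [← lintegral_ofReal_ne_top_iff_integrable hcont.aestronglyMeasurable
      (ae_of_all _ fun w => sq_nonneg _)]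
    exact ne_top_of_le_ne_top ENNReal.ofReal_ne_top hlin
  have hLp' : MemLp (fun w => w - v) 2 (stepLaw X Y α ν μ) :=
    (memLp_two_iff_integrable_sq_norm (by fun_prop)).2 hsq'
  have hprob' := isProbabilityMeasure_stepLaw (X := X) (Y := Y) (α := α) (ν := ν) μ
  refine ⟨⟨hprob', hLp', ae_mem_stepLaw hmem, fun e => ?_⟩, ?_⟩
  · have hi : Integrable (fun w => inner ℝ (w - v) e) (stepLaw X Y α ν μ) :=
      (hLp'.integrable one_le_two).inner_const e
    have hi2 := hi
    rw [stepLaw, integrable_map_measure hi.aestronglyMeasurable hmeas.aemeasurable] at hi2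
    rw [stepLaw, integral_map hmeas.aemeasurable hi.aestronglyMeasurable,
      integral_prod_symm (fun p : (Fin n → ℝ) × EuclideanSpace ℝ (Fin d) =>
        inner ℝ (wgdStep X Y α p.1 p.2 - v) e) hi2]
    simp only [wgdStep_sub, ← hr, integral_inner_step hb hrn]
    -- The symmetric mean step is moved onto the test vector, where the mean-zero property of μ
    -- applies.
    have hsymm : ∀ u : EuclideanSpace ℝ (Fin d),
        inner ℝ (u - α • toEuclideanLin (weightedGram X ν) u) e
          = inner ℝ u (e - α • toEuclideanLin (weightedGram X ν) e) := by
      intro u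
      rw [inner_sub_left, inner_sub_right, inner_smul_left, inner_smul_right,
        (isPositive_weightedGram X ν).isSymmetric]
      rfl
    simp only [hsymm, hmean]
  · rw [← hHval]
    rw [← ofReal_integral_eq_lintegral_ofReal hsq' (ae_of_all _ fun w => sq_nonneg _)] at hlin
    exact (ENNReal.ofReal_le_ofReal_iff
      (integral_nonneg_of_ae (hstep.mono fun w h => h.2))).1 hlin

/-- The value αQ(r)/σ is the fixed point of s ↦ (1 - ασ)s + α²Q(r). This map is monotone since ασ ≤
1, so iteration from s = 0 stays below the fixed point. -/
theorem IsCenteredLaw.iterate_stepLaw [IsProbabilityMeasure ν]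
    (hb : ∀ᵐ δ ∂ν, ∀ i, δ i ^ 2 ≤ τ ^ 2) (hM : IsUnit (secondMoment ν)) (hα : 0 < α)
    (hα1 : α * ‖weightedGram X ν‖ < 1)
    (hα2 : α < sigmaMinPos (weightedGram X ν) /
      (sigmaMinPos (weightedGram X ν) ^ 2 + ‖X‖ ^ 4 * ‖covSq ν‖)) (k : ℕ) :
    IsCenteredLaw X (wHat X Y ν) ((stepLaw X Y α ν)^[k] (Measure.dirac (wHat X Y ν))) ∧
      sigmaMinPos (weightedGram X ν) * ∫ w, ‖w - wHat X Y ν‖ ^ 2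
          ∂((stepLaw X Y α ν)^[k] (Measure.dirac (wHat X Y ν)))
        ≤ α * noiseForm X ν (Y - toEuclideanLin X (wHat X Y ν)).ofLp := by
  obtain ⟨hσ, hα3⟩ := step_size_bound hα (by positivity) hα2
  set σ := sigmaMinPos (weightedGram X ν)
  induction k with
  | zero =>
    refine ⟨isCenteredLaw_dirac (wHat_mem_orthogonal_ker X Y ν), ?_⟩
    -- At u = 0 with step size 1 the mean square is the noise form itself, which is therefore
    -- non-negative.
    obtain ⟨hi, he⟩ := integral_step_sq hb (gradVec_residual_wHat X Y ν) 1 0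
    have h0 : 0 ≤ noiseForm X ν (Y - toEuclideanLin X (wHat X Y ν)).ofLp := by
      have h1 : noiseForm X ν (fun i => toEuclideanLin X 0 i
          - (Y - toEuclideanLin X (wHat X Y ν)) i)
          = noiseForm X ν (Y - toEuclideanLin X (wHat X Y ν)).ofLp := by
        simp only [noiseForm, map_zero, PiLp.zero_apply, zero_sub, neg_mul_neg]
      rw [h1] at he
      simp only [map_zero, smul_zero, sub_zero, norm_zero, one_pow, one_mul] at he
      have h2 : (0 : ℝ) ^ 2 + noiseForm X ν (Y - toEuclideanLin X (wHat X Y ν)).ofLp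
          = noiseForm X ν (Y - toEuclideanLin X (wHat X Y ν)).ofLp := by ring
      rw [h2] at he
      rw [← he]
      exact integral_nonneg fun δ => sq_nonneg _
    simp only [Function.iterate_zero, id_eq, integral_dirac, sub_self, norm_zero]
    have := mul_nonneg hα.le h0
    linarith
  | succ k ih =>
    obtain ⟨ih1, ih2⟩ := ih
    rw [Function.iterate_succ_apply']
    obtain ⟨h1, h2⟩ := ih1.step hb hM hα hα1 hα2
    refine ⟨h1, ?_⟩
    have h3 : 0 ≤ 1 - α * σ := by
      by_contra hneg
      have : 0 ≤ α * (‖X‖ ^ 4 * ‖covSq ν‖) := by positivity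
      nlinarith
    have h4 := mul_le_mul_of_nonneg_left h2 hσ.le
    have h5 := mul_le_mul_of_nonneg_left ih2 h3
    refine h4.trans ?_
    nlinarith

end Laws

/-! ### Splitting off the first term of an i.i.d. sequence. -/

section Sequences

variable {Z : Type*} [MeasurableSpace Z]

theorem measurePreserving_head_tail (ν : Measure Z) [IsProbabilityMeasure ν] :
    MeasurePreserving (fun f : ℕ → Z => (f 0, fun k => f (k + 1)))
      (Measure.infinitePi fun _ : ℕ => ν) (ν.prod (Measure.infinitePi fun _ : ℕ => ν)) := by
  set cons : Z × (ℕ → Z) → ℕ → Z := fun p k => Nat.casesOn k p.1 p.2 with hcons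
  have hmeas : Measurable cons := by
    refine measurable_pi_iff.2 fun k => ?_
    cases k with
    | zero => exact measurable_fst
    | succ k => exact (measurable_pi_apply k).comp measurable_snd
  have hsplit : Measurable (fun f : ℕ → Z => (f 0, fun k => f (k + 1))) := by fun_prop
  have hmap : (ν.prod (Measure.infinitePi fun _ : ℕ => ν)).map cons
      = Measure.infinitePi fun _ : ℕ => ν := by
    refine Measure.eq_infinitePi _ fun s t ht => ?_
    classical
    obtain ⟨N, hN⟩ := s.exists_nat_subset_range
    -- Filling up with the whole space turns a box over s into one over an initial segment, whose
    -- preimage under `cons` is a product.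
    set t' : ℕ → Set Z := fun i => if i ∈ s then t i else Set.univ with ht'
    have hmt' : ∀ i, MeasurableSet (t' i) := fun i => by
      simp only [ht']
      split_ifs
      exacts [ht i, .univ]
    have hpre : cons ⁻¹' (Set.pi s t)
        = t' 0 ×ˢ Set.pi (Finset.range N) (fun i => t' (i + 1)) := by
      ext p
      simp only [Set.mem_preimage, Set.mem_pi, Set.mem_prod, ht', Finset.mem_coe,
        Finset.mem_range]
      constructor
      · intro h
        refine ⟨?_, fun i _ => ?_⟩
        · split_ifs with h0
          exacts [h 0 h0, trivial]
        · split_ifs with h0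
          exacts [h (i + 1) h0, trivial]
      · rintro ⟨h0, h1⟩ i hi
        cases i with
        | zero =>
          have h2 : p.1 ∈ t 0 := by simpa [hi] using h0
          exact h2
        | succ i =>
          have := h1 i (by have := Finset.mem_range.1 (hN hi); omega)
          have h2 : p.2 i ∈ t (i + 1) := by simpa [hi] using this
          exact h2
    rw [Measure.map_apply hmeas (MeasurableSet.pi s.countable_toSet fun i _ => ht i), hpre,
      Measure.prod_prod, Measure.infinitePi_pi _ fun i _ => hmt' (i + 1)]
    have h1 : ∏ i ∈ s, ν (t i) = ∏ i ∈ Finset.range (N + 1), ν (t' i) := by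
      have h2 : ∏ i ∈ s, ν (t i) = ∏ i ∈ s, ν (t' i) :=
        Finset.prod_congr rfl fun i hi => by simp [ht', hi]
      rw [h2]
      refine Finset.prod_subset (hN.trans (Finset.range_mono (Nat.le_succ N))) fun i _ hi => ?_
      simp [ht', hi]
    rw [h1, Finset.prod_range_succ', mul_comm]
  refine ⟨hsplit, ?_⟩
  conv_lhs => rw [← hmap]
  rw [Measure.map_map hsplit hmeas]
  exact Measure.map_id

theorem measurePreserving_consume_head {W : Type*} [MeasurableSpace W] {ν : Measure Z}
    [IsProbabilityMeasure ν] {μ μ' : Measure W} [SFinite μ] [SFinite μ'] {F : Z × W → W}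
    (hF : MeasurePreserving F (ν.prod μ) μ') :
    MeasurePreserving (fun p : W × (ℕ → Z) => (F (p.2 0, p.1), fun k => p.2 (k + 1)))
      (μ.prod (Measure.infinitePi fun _ : ℕ => ν))
      (μ'.prod (Measure.infinitePi fun _ : ℕ => ν)) := by
  set Q := Measure.infinitePi fun _ : ℕ => ν
  have h1 := (MeasurePreserving.id μ).prod (measurePreserving_head_tail ν)
  have h2 := ((measurePreserving_prodAssoc μ ν Q).symm).comp h1
  have h3 := ((Measure.measurePreserving_swap (μ := μ) (ν := ν)).prod
    (MeasurePreserving.id Q)).comp h2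
  exact (hF.prod (MeasurePreserving.id Q)).comp h3

end Sequences

/-! ### Laws of the iterates and synchronous contraction. -/

section Iterates

variable {n d : ℕ} {ν : Measure (Fin n → ℝ)} {τ α : ℝ} {X : Matrix (Fin n) (Fin d) ℝ}
  {Y : EuclideanSpace ℝ (Fin n)}

theorem measurable_wgdStep {Z : Type*} [MeasurableSpace Z] {f : Z → Fin n → ℝ}
    {g : Z → EuclideanSpace ℝ (Fin d)} (hf : Measurable f) (hg : Measurable g) :
    Measurable fun z => wgdStep X Y α (f z) (g z) := by
  have h := (continuous_wgdStep X Y α).measurable.comp (hf.prodMk hg)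
  simpa only [Function.comp_def] using h

theorem wgdIter_succ {Ω : Type*} (D : ℕ → Ω → Fin n → ℝ) (w₁ : Ω → EuclideanSpace ℝ (Fin d))
    (k : ℕ) (ω : Ω) :
    wgdIter X Y α D w₁ (k + 1) ω = wgdStep X Y α (D k ω) (wgdIter X Y α D w₁ k ω) :=
  rfl

theorem wgdIter_zero {Ω : Type*} (D : ℕ → Ω → Fin n → ℝ) (w₁ : Ω → EuclideanSpace ℝ (Fin d))
    (ω : Ω) : wgdIter X Y α D w₁ 0 ω = w₁ ω :=
  rfl

theorem measurable_wgdIter {Ω : Type*} [MeasurableSpace Ω] {D : ℕ → Ω → Fin n → ℝ}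
    {w₁ : Ω → EuclideanSpace ℝ (Fin d)} (hD : ∀ k, Measurable (D k)) (hw : Measurable w₁) (k : ℕ) :
    Measurable (wgdIter X Y α D w₁ k) := by
  induction k with
  | zero => exact hw
  | succ k ih => exact measurable_wgdStep (hD k) ih

theorem map_wgdStep_comp_snd [IsProbabilityMeasure ν] {Z : Type*} [MeasurableSpace Z]
    {Q : Measure Z} [SFinite Q] {g : Z → EuclideanSpace ℝ (Fin d)} (hg : Measurable g) :
    (ν.prod Q).map (fun p => wgdStep X Y α p.1 (g p.2)) = stepLaw X Y α ν (Q.map g) := by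
  have h : ν.prod (Q.map g) = (ν.prod Q).map (Prod.map id g) := by
    rw [← Measure.map_prod_map _ _ measurable_id hg, Measure.map_id]
  rw [stepLaw, h, Measure.map_map (continuous_wgdStep X Y α).measurable (measurable_id.prodMap hg)]
  simp only [Function.comp_def, Prod.map_fst, Prod.map_snd, id_eq]

/-- The induction removes the first step: it changes the initial law and shifts the weightings,
whose law is unaffected. Hence μ has to be arbitrary in the induction. -/
theorem map_wgdIter_prod_infinitePi [IsProbabilityMeasure ν] (k : ℕ) :
    ∀ (μ : Measure (EuclideanSpace ℝ (Fin d))) [IsProbabilityMeasure μ],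
      (μ.prod (Measure.infinitePi fun _ : ℕ => ν)).map
        (wgdIter X Y α (fun k p => p.2 k) Prod.fst k) = (stepLaw X Y α ν)^[k] μ := by
  induction k with
  | zero =>
    intro μ _
    exact Measure.map_fst_prod.trans (by simp)
  | succ k ih =>
    intro μ _
    have := isProbabilityMeasure_stepLaw (X := X) (Y := Y) (α := α) (ν := ν) μ
    rw [Function.iterate_succ_apply, ← ih]
    set Q := Measure.infinitePi fun _ : ℕ => ν
    set T : EuclideanSpace ℝ (Fin d) × (ℕ → Fin n → ℝ)
        → EuclideanSpace ℝ (Fin d) × (ℕ → Fin n → ℝ) :=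
      fun p => (wgdStep X Y α (p.2 0) p.1, fun k => p.2 (k + 1)) with hT
    have hstep : MeasurePreserving (fun p : (Fin n → ℝ) × EuclideanSpace ℝ (Fin d) =>
        wgdStep X Y α p.1 p.2) (ν.prod μ) (stepLaw X Y α ν μ) :=
      ⟨(continuous_wgdStep X Y α).measurable, rfl⟩
    have hTp : MeasurePreserving T (μ.prod Q) ((stepLaw X Y α ν μ).prod Q) :=
      measurePreserving_consume_head hstep
    have hcomm : ∀ (j : ℕ) (p : EuclideanSpace ℝ (Fin d) × (ℕ → Fin n → ℝ)),
        wgdIter X Y α (fun k (p : EuclideanSpace ℝ (Fin d) × (ℕ → Fin n → ℝ)) => p.2 k)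
          Prod.fst (j + 1) p = wgdIter X Y α (fun k p => p.2 k) Prod.fst j (T p) := by
      intro j p
      induction j with
      | zero => rw [wgdIter_succ, wgdIter_zero, wgdIter_zero]
      | succ j ihj => rw [wgdIter_succ, ihj, wgdIter_succ]
    have hmeas : Measurable (wgdIter X Y α
        (fun k (p : EuclideanSpace ℝ (Fin d) × (ℕ → Fin n → ℝ)) => p.2 k) Prod.fst k) :=
      measurable_wgdIter (fun k => by fun_prop) measurable_fst k
    rw [← hTp.map_eq, Measure.map_map hmeas hTp.measurable]
    congr 1
    ext1 p
    rw [Function.comp_apply, hcomm]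

/-- The law of the iterates is obtained by iterating the one-step map on laws. -/
theorem map_wgdIter [IsProbabilityMeasure ν] {μ₁ : Measure (EuclideanSpace ℝ (Fin d))}
    [IsProbabilityMeasure μ₁] {Ω : Type*} [MeasurableSpace Ω] {P : Measure Ω}
    [IsProbabilityMeasure P] {D : ℕ → Ω → Fin n → ℝ} {w₁ : Ω → EuclideanSpace ℝ (Fin d)}
    (hD : ∀ k, Measurable (D k)) (hw : Measurable w₁) (hDν : ∀ k, P.map (D k) = ν)
    (hwμ : P.map w₁ = μ₁) (hind : iIndepFun D P) (hind' : IndepFun w₁ (fun ω k => D k ω) P)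
    (k : ℕ) : P.map (wgdIter X Y α D w₁ k) = (stepLaw X Y α ν)^[k] μ₁ := by
  have hDm : Measurable fun ω k => D k ω := measurable_pi_iff.2 hD
  have h1 : P.map (fun ω => (w₁ ω, fun k => D k ω))
      = μ₁.prod (Measure.infinitePi fun _ : ℕ => ν) := by
    rw [(indepFun_iff_map_prod_eq_prod_map_map hw.aemeasurable hDm.aemeasurable).1 hind', hwμ,
      (iIndepFun_iff_map_fun_eq_infinitePi_map hD).1 hind]
    simp only [hDν]
  have h2 : wgdIter X Y α D w₁ k = wgdIter X Y α
      (fun k (p : EuclideanSpace ℝ (Fin d) × (ℕ → Fin n → ℝ)) => p.2 k) Prod.fst k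
        ∘ fun ω => (w₁ ω, fun k => D k ω) := by
    induction k with
    | zero => rfl
    | succ k ih =>
      ext1 ω
      rw [wgdIter_succ, ih, Function.comp_apply, Function.comp_apply, wgdIter_succ]
  rw [h2, ← Measure.map_map (measurable_wgdIter (fun k => by fun_prop) measurable_fst k)
    (hw.prodMk hDm), h1, map_wgdIter_prod_infinitePi]

/-- Contraction in mean square of two points that are moved by the same random step. -/
theorem lintegral_wgdStep_sub_wgdStep_le [IsProbabilityMeasure ν]
    (hb : ∀ᵐ δ ∂ν, ∀ i, δ i ^ 2 ≤ τ ^ 2) (hM : IsUnit (secondMoment ν)) (hα : 0 < α)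
    (hατ : α * τ ^ 2 * ‖Xᵀ * X‖ < 2) {Z : Type*} [MeasurableSpace Z] {Q : Measure Z} [SFinite Q]
    {g h : Z → EuclideanSpace ℝ (Fin d)} (hg : Measurable g) (hh : Measurable h)
    (hgh : ∀ᵐ z ∂Q, g z - h z ∈ (LinearMap.ker (toEuclideanLin X))ᗮ) :
    ∫⁻ p, ‖wgdStep X Y α p.1 (g p.2) - wgdStep X Y α p.1 (h p.2)‖ₑ ^ (2 : ℝ) ∂(ν.prod Q)
      ≤ ENNReal.ofReal (Real.exp
          (-(α * (2 - α * τ ^ 2 * ‖Xᵀ * X‖) * sigmaMinPos (weightedGram X ν))))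
        * ∫⁻ z, ‖g z - h z‖ₑ ^ (2 : ℝ) ∂Q := by
  have hm : ∀ {f : Z → EuclideanSpace ℝ (Fin d)}, Measurable f →
      Measurable fun p : (Fin n → ℝ) × Z => wgdStep X Y α p.1 (f p.2) := fun hf =>
    measurable_wgdStep measurable_fst (hf.comp measurable_snd)
  have hm2 : Measurable fun z => ‖g z - h z‖ₑ ^ (2 : ℝ) := (hg.sub hh).enorm.pow_const _
  rw [lintegral_prod_symm' (fun p : (Fin n → ℝ) × Z =>
      ‖wgdStep X Y α p.1 (g p.2) - wgdStep X Y α p.1 (h p.2)‖ₑ ^ (2 : ℝ)) (((hm hg).sub (hm hh)).enorm.pow_const _),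
    ← lintegral_const_mul _ hm2]
  refine lintegral_mono_ae ?_
  filter_upwards [hgh] with z hz
  simp only [wgdStep_sub_wgdStep]
  exact lintegral_step_sq_le hb hM X hα hατ hz

end Iterates

/-! ### The stationary law as a limit of backward iterates. -/

section Stationary

open Filter Topology

variable {n d : ℕ} {ν : Measure (Fin n → ℝ)} {τ α : ℝ} {X : Matrix (Fin n) (Fin d) ℝ}
  {Y : EuclideanSpace ℝ (Fin n)}

/-- Almost sure convergence from geometric decay of the increments in mean square. -/
theorem ae_exists_tendsto_of_lintegral_sq_le {Z : Type*} [MeasurableSpace Z] {Q : Measure Z}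
    [IsProbabilityMeasure Q] {E : Type*} [NormedAddCommGroup E] [CompleteSpace E]
    [MeasurableSpace E] [BorelSpace E] [SecondCountableTopology E] {f : ℕ → Z → E}
    (hf : ∀ k, Measurable (f k))
    {ρ a : ℝ≥0∞} (hρ : ρ < 1) (ha : a ≠ ∞)
    (h : ∀ k, ∫⁻ z, ‖f (k + 1) z - f k z‖ₑ ^ (2 : ℝ) ∂Q ≤ ρ ^ k * a) :
    ∀ᵐ z ∂Q, ∃ l, Tendsto (fun k => f k z) atTop (𝓝 l) := by
  have hm : ∀ k, Measurable fun z => ‖f (k + 1) z - f k z‖ₑ := fun k =>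
    ((hf (k + 1)).sub (hf k)).enorm
  -- On a probability space the L¹ norm is at most the L² norm. The increments then have summable
  -- means, so almost surely they are summable and the sequence is Cauchy.
  have h1 : ∀ k, ∫⁻ z, ‖f (k + 1) z - f k z‖ₑ ∂Q
      ≤ (ρ ^ (1 / 2 : ℝ)) ^ k * a ^ (1 / 2 : ℝ) := by
    intro k
    have h2 := eLpNorm'_le_eLpNorm'_of_exponent_le (zero_lt_one) (one_le_two (α := ℝ)) Q
      ((hf (k + 1)).sub (hf k)).aestronglyMeasurable
    simp only [eLpNorm', ENNReal.rpow_one, one_div, inv_one, Pi.sub_apply] at h2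
    refine h2.trans ((ENNReal.rpow_le_rpow (h k) (by norm_num)).trans (le_of_eq ?_))
    rw [ENNReal.mul_rpow_of_nonneg _ _ (by norm_num), ← ENNReal.rpow_natCast,
      ← ENNReal.rpow_natCast, ← ENNReal.rpow_mul, ← ENNReal.rpow_mul, mul_comm (k : ℝ), one_div]
  have hsum : ∫⁻ z, ∑' k, ‖f (k + 1) z - f k z‖ₑ ∂Q ≠ ∞ := by
    rw [lintegral_tsum fun k => (hm k).aemeasurable]
    refine ne_top_of_le_ne_top ?_ (ENNReal.tsum_le_tsum h1)
    rw [ENNReal.tsum_mul_right, ENNReal.tsum_geometric]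
    refine ENNReal.mul_ne_top (ENNReal.inv_ne_top.2 ?_) (ENNReal.rpow_ne_top_of_nonneg
      (by norm_num) ha)
    exact (tsub_pos_of_lt (ENNReal.rpow_lt_one hρ (by norm_num))).ne'
  filter_upwards [ae_lt_top (Measurable.tsum hm) hsum] with z hz
  refine cauchySeq_tendsto_of_complete (cauchySeq_of_edist_le_of_tsum_ne_top _ (fun k => ?_) hz.ne)
  rw [edist_comm, edist_eq_enorm_sub]

/-- Backward iterates: the most recent step uses the first weighting. -/
noncomputable def backIter (X : Matrix (Fin n) (Fin d) ℝ) (Y : EuclideanSpace ℝ (Fin n)) (α : ℝ)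
    (v : EuclideanSpace ℝ (Fin d)) : ℕ → (ℕ → Fin n → ℝ) → EuclideanSpace ℝ (Fin d)
  | 0 => fun _ => v
  | k + 1 => fun f => wgdStep X Y α (f 0) (backIter X Y α v k fun j => f (j + 1))

theorem backIter_succ (v : EuclideanSpace ℝ (Fin d)) (k : ℕ) (f : ℕ → Fin n → ℝ) :
    backIter X Y α v (k + 1) f
      = wgdStep X Y α (f 0) (backIter X Y α v k fun j => f (j + 1)) := rfl

theorem measurable_backIter (v : EuclideanSpace ℝ (Fin d)) (k : ℕ) :
    Measurable (backIter X Y α v k) := by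
  induction k with
  | zero => exact measurable_const
  | succ k ih =>
    exact measurable_wgdStep (measurable_pi_apply 0)
      (ih.comp (measurable_pi_iff.2 fun j => measurable_pi_apply (j + 1)))

theorem backIter_mem {v : EuclideanSpace ℝ (Fin d)}
    (hv : v ∈ (LinearMap.ker (toEuclideanLin X))ᗮ) (k : ℕ) :
    ∀ f, backIter X Y α v k f ∈ (LinearMap.ker (toEuclideanLin X))ᗮ := by
  induction k with
  | zero => exact fun _ => hv
  | succ k ih => exact fun f => wgdStep_mem_orthogonal_ker Y α _ (ih _)

/-- The head is independent of the tail. Applied to g = W, the limit of the backward iterates, this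
is stationarity. -/
theorem map_step_infinitePi [IsProbabilityMeasure ν]
    {g : (ℕ → Fin n → ℝ) → EuclideanSpace ℝ (Fin d)} (hg : Measurable g) :
    (Measure.infinitePi fun _ : ℕ => ν).map (fun f => wgdStep X Y α (f 0) (g fun j => f (j + 1)))
      = stepLaw X Y α ν ((Measure.infinitePi fun _ : ℕ => ν).map g) := by
  have hm : Measurable fun p : (Fin n → ℝ) × (ℕ → Fin n → ℝ) => wgdStep X Y α p.1 (g p.2) :=
    measurable_wgdStep measurable_fst (hg.comp measurable_snd)
  rw [← map_wgdStep_comp_snd hg, ← (measurePreserving_head_tail ν).map_eq,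
    Measure.map_map hm (measurePreserving_head_tail ν).measurable]
  simp only [Function.comp_def]

/-- Reversing the order of i.i.d. weightings does not change the law for fixed k, whereas pathwise
convergence holds for the backward order. -/
theorem map_backIter [IsProbabilityMeasure ν] (v : EuclideanSpace ℝ (Fin d)) (k : ℕ) :
    (Measure.infinitePi fun _ : ℕ => ν).map (backIter X Y α v k)
      = (stepLaw X Y α ν)^[k] (Measure.dirac v) := by
  induction k with
  | zero =>
    have h : backIter X Y α v 0 = fun _ => v := rfl
    rw [h, Measure.map_const, measure_univ, one_smul]
    rfl
  | succ k ih =>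
    rw [Function.iterate_succ_apply', ← ih, ← map_step_infinitePi (measurable_backIter v k)]
    rfl

/-- Consecutive backward iterates share their outer k steps and differ by one step from v inside;
each shared step contributes one contraction factor. -/
theorem lintegral_backIter_sub_le [IsProbabilityMeasure ν]
    (hb : ∀ᵐ δ ∂ν, ∀ i, δ i ^ 2 ≤ τ ^ 2) (hM : IsUnit (secondMoment ν)) (hα : 0 < α)
    (hατ : α * τ ^ 2 * ‖Xᵀ * X‖ < 2) {v : EuclideanSpace ℝ (Fin d)}
    (hv : v ∈ (LinearMap.ker (toEuclideanLin X))ᗮ) (k : ℕ) :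
    ∫⁻ f, ‖backIter X Y α v (k + 1) f - backIter X Y α v k f‖ₑ ^ (2 : ℝ)
        ∂(Measure.infinitePi fun _ : ℕ => ν)
      ≤ ENNReal.ofReal (Real.exp
          (-(α * (2 - α * τ ^ 2 * ‖Xᵀ * X‖) * sigmaMinPos (weightedGram X ν)))) ^ k
        * ∫⁻ w, ‖w - v‖ₑ ^ (2 : ℝ) ∂(stepLaw X Y α ν (Measure.dirac v)) := by
  set Q := Measure.infinitePi fun _ : ℕ => ν
  induction k with
  | zero =>
    have h1 := map_backIter (X := X) (Y := Y) (α := α) (ν := ν) v 1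
    rw [Function.iterate_one] at h1
    rw [← h1, lintegral_map (by fun_prop) (measurable_backIter v 1), pow_zero, one_mul]
    rfl
  | succ k ih =>
    have hg := measurable_backIter (X := X) (Y := Y) (α := α) v (k + 1)
    have hh := measurable_backIter (X := X) (Y := Y) (α := α) v k
    have h1 := lintegral_wgdStep_sub_wgdStep_le (Y := Y) hb hM hα hατ (Q := Q) hg hh
      (ae_of_all _ fun f => Submodule.sub_mem _ (backIter_mem hv _ f) (backIter_mem hv _ f))
    have hm : Measurable fun p : (Fin n → ℝ) × (ℕ → Fin n → ℝ) =>
        ‖wgdStep X Y α p.1 (backIter X Y α v (k + 1) p.2)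
          - wgdStep X Y α p.1 (backIter X Y α v k p.2)‖ₑ ^ (2 : ℝ) :=
      ((measurable_wgdStep measurable_fst (hg.comp measurable_snd)).sub
        (measurable_wgdStep measurable_fst (hh.comp measurable_snd))).enorm.pow_const _
    rw [← (measurePreserving_head_tail ν).map_eq, lintegral_map hm
      (measurePreserving_head_tail ν).measurable] at h1
    exact h1.trans ((mul_le_mul_right ih _).trans (le_of_eq (by ring)))

/-- Existence of a stationary law on `ker(X)ᗮ`, with a bound for its mean square distance to `ŵ`. -/
theorem exists_isStationaryLaw [IsProbabilityMeasure ν]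
    (hb : ∀ᵐ δ ∂ν, ∀ i, δ i ^ 2 ≤ τ ^ 2) (hM : IsUnit (secondMoment ν)) (hα : 0 < α)
    (hατ : α * τ ^ 2 * ‖Xᵀ * X‖ < 2) (hα1 : α * ‖weightedGram X ν‖ < 1)
    (hα2 : α < sigmaMinPos (weightedGram X ν) /
      (sigmaMinPos (weightedGram X ν) ^ 2 + ‖X‖ ^ 4 * ‖covSq ν‖)) :
    ∃ μ : Measure (EuclideanSpace ℝ (Fin d)), IsStationaryLaw X Y α ν μ ∧
      (∀ᵐ w ∂μ, w ∈ (LinearMap.ker (toEuclideanLin X))ᗮ) ∧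
      ∫⁻ w, ‖w - wHat X Y ν‖ₑ ^ (2 : ℝ) ∂μ
        ≤ ENNReal.ofReal (α * noiseForm X ν (Y - toEuclideanLin X (wHat X Y ν)).ofLp
          / sigmaMinPos (weightedGram X ν)) := by
  set v := wHat X Y ν with hvdef
  set Q := Measure.infinitePi fun _ : ℕ => ν with hQ
  set B : ℝ := α * noiseForm X ν (Y - toEuclideanLin X v).ofLp / sigmaMinPos (weightedGram X ν)
  have hv : v ∈ (LinearMap.ker (toEuclideanLin X))ᗮ := wHat_mem_orthogonal_ker X Y ν
  obtain ⟨hσ, -⟩ := step_size_bound hα (by positivity) hα2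
  have hlaw : ∀ k, ∫⁻ w, ‖w - v‖ₑ ^ (2 : ℝ) ∂((stepLaw X Y α ν)^[k] (Measure.dirac v))
      ≤ ENNReal.ofReal B := by
    intro k
    obtain ⟨h1, h2⟩ := IsCenteredLaw.iterate_stepLaw (Y := Y) hb hM hα hα1 hα2 k
    simp only [← ofReal_norm_sq_eq_enorm_rpow]
    rw [← ofReal_integral_eq_lintegral_ofReal (h1.memLp.integrable_norm_pow two_ne_zero)
      (ae_of_all _ fun w => sq_nonneg _)]
    refine ENNReal.ofReal_le_ofReal ((le_div_iff₀ hσ).2 ?_)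
    rw [mul_comm]
    exact h2
  set ρ := ENNReal.ofReal (Real.exp
    (-(α * (2 - α * τ ^ 2 * ‖Xᵀ * X‖) * sigmaMinPos (weightedGram X ν)))) with hρdef
  have hρ : ρ < 1 := by
    rw [hρdef, ENNReal.ofReal_lt_one, Real.exp_lt_one_iff, neg_lt_zero]
    exact mul_pos (mul_pos hα (by linarith)) hσ
  have hae := ae_exists_tendsto_of_lintegral_sq_le (Q := Q) (measurable_backIter v) hρ
    (ne_top_of_le_ne_top ENNReal.ofReal_ne_top (hlaw 1))
    (lintegral_backIter_sub_le (Y := Y) hb hM hα hατ hv)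
  obtain ⟨W, hW, hlim⟩ := measurable_limit_of_tendsto_metrizable_ae
    (fun k => (measurable_backIter v k).aemeasurable) hae
  have htail : MeasurePreserving (fun (f : ℕ → Fin n → ℝ) (j : ℕ) => f (j + 1)) Q Q :=
    measurePreserving_snd.comp (measurePreserving_head_tail ν)
  -- Passing to the limit in the backward recursion, by continuity of a step in its starting point.
  have hfix : W =ᵐ[Q] fun f => wgdStep X Y α (f 0) (W fun j => f (j + 1)) := by
    filter_upwards [hlim, htail.quasiMeasurePreserving.ae hlim] with f hf hf'
    have h1 : Tendsto (fun k => backIter X Y α v (k + 1) f) atTop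
        (𝓝 (wgdStep X Y α (f 0) (W fun j => f (j + 1)))) := by
      simp only [backIter_succ]
      have h2 := ((continuous_wgdStep X Y α).comp (Continuous.prodMk_right (f 0))).tendsto
        (W fun j => f (j + 1))
      have h3 := h2.comp hf'
      simpa only [Function.comp_def] using h3
    exact tendsto_nhds_unique ((tendsto_add_atTop_iff_nat 1).2 hf) h1
  refine ⟨Q.map W, ⟨Measure.isProbabilityMeasure_map hW.aemeasurable, ?_⟩, ?_, ?_⟩
  · have h1 := map_step_infinitePi (X := X) (Y := Y) (α := α) (ν := ν) hW
    rw [← Measure.map_congr hfix] at h1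
    exact h1.symm
  · rw [ae_map_iff (p := (· ∈ (LinearMap.ker (toEuclideanLin X))ᗮ)) hW.aemeasurable
      (Submodule.isClosed_orthogonal _).measurableSet]
    filter_upwards [hlim] with f hf
    exact (Submodule.isClosed_orthogonal _).mem_of_tendsto hf
      (Eventually.of_forall fun k => backIter_mem hv k f)
  · have hm : Measurable fun w : EuclideanSpace ℝ (Fin d) => ‖w - v‖ₑ ^ (2 : ℝ) := by fun_prop
    rw [lintegral_map hm hW]
    have hc : Continuous fun w : EuclideanSpace ℝ (Fin d) => ‖w - v‖ₑ ^ (2 : ℝ) := by fun_prop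
    -- Fatou's lemma: the uniform bound for the laws started at ŵ survives in the limit.
    calc ∫⁻ f, ‖W f - v‖ₑ ^ (2 : ℝ) ∂Q
        = ∫⁻ f, liminf (fun k => ‖backIter X Y α v k f - v‖ₑ ^ (2 : ℝ)) atTop ∂Q := by
          refine lintegral_congr_ae ?_
          filter_upwards [hlim] with f hf
          exact (((hc.tendsto _).comp hf).liminf_eq).symm
      _ ≤ liminf (fun k => ∫⁻ f, ‖backIter X Y α v k f - v‖ₑ ^ (2 : ℝ) ∂Q) atTop :=
          lintegral_liminf_le fun k => hm.comp (measurable_backIter v k)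
      _ ≤ ENNReal.ofReal B := by
          refine liminf_le_of_le (by isBoundedDefault) fun b hb' => ?_
          obtain ⟨k, hk⟩ := hb'.exists
          refine hk.trans ?_
          rw [← lintegral_map hm (measurable_backIter v k), map_backIter]
          exact hlaw k

end Stationary

/-! ### Couplings and constants independent of the law of the weightings. -/

section Wasserstein

variable {n d : ℕ} {ν : Measure (Fin n → ℝ)} {τ α : ℝ} {X : Matrix (Fin n) (Fin d) ℝ}
  {Y : EuclideanSpace ℝ (Fin n)}

theorem wasserstein_le {μ π : Measure (EuclideanSpace ℝ (Fin d))}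
    {γ : Measure (EuclideanSpace ℝ (Fin d) × EuclideanSpace ℝ (Fin d))} (q : ℝ)
    [IsProbabilityMeasure γ] (h1 : γ.fst = μ) (h2 : γ.snd = π) :
    wasserstein q μ π ≤ (∫⁻ p, ‖p.1 - p.2‖ₑ ^ q ∂γ) ^ (1 / q) :=
  iInf₂_le γ ⟨inferInstance, h1, h2⟩

theorem wasserstein_dirac_le (μ : Measure (EuclideanSpace ℝ (Fin d))) [IsProbabilityMeasure μ]
    (v : EuclideanSpace ℝ (Fin d)) (q : ℝ) :
    wasserstein q μ (Measure.dirac v) ≤ (∫⁻ w, ‖w - v‖ₑ ^ q ∂μ) ^ (1 / q) := by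
  have hm : Measurable fun w : EuclideanSpace ℝ (Fin d) => (w, v) := by fun_prop
  have := Measure.isProbabilityMeasure_map (μ := μ) hm.aemeasurable
  refine (wasserstein_le (γ := μ.map fun w => (w, v)) q ?_ ?_).trans (le_of_eq ?_)
  · rw [Measure.fst, Measure.map_map measurable_fst hm]
    exact Measure.map_id
  · rw [Measure.snd, Measure.map_map measurable_snd hm]
    exact (Measure.map_const _ _).trans (by simp)
  · rw [lintegral_map (by fun_prop) hm]

theorem lintegral_sq_rpow_add_le {Z : Type*} [MeasurableSpace Z] {Q : Measure Z}
    {E : Type*} [NormedAddCommGroup E] {f g : Z → E} (hf : AEStronglyMeasurable f Q)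
    (hg : AEStronglyMeasurable g Q) :
    (∫⁻ z, ‖f z + g z‖ₑ ^ (2 : ℝ) ∂Q) ^ (1 / 2 : ℝ)
      ≤ (∫⁻ z, ‖f z‖ₑ ^ (2 : ℝ) ∂Q) ^ (1 / 2 : ℝ) + (∫⁻ z, ‖g z‖ₑ ^ (2 : ℝ) ∂Q) ^ (1 / 2 : ℝ) :=
  eLpNorm'_add_le hf hg one_le_two

/-- Moving two independent starting points by the same random steps gives couplings of contracting
cost. -/
theorem exists_coupling_iterate_stepLaw [IsProbabilityMeasure ν]
    (hb : ∀ᵐ δ ∂ν, ∀ i, δ i ^ 2 ≤ τ ^ 2) (hM : IsUnit (secondMoment ν)) (hα : 0 < α)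
    (hατ : α * τ ^ 2 * ‖Xᵀ * X‖ < 2) {μ π : Measure (EuclideanSpace ℝ (Fin d))}
    [IsProbabilityMeasure μ] (hπ : IsStationaryLaw X Y α ν π)
    (hμV : ∀ᵐ w ∂μ, w ∈ (LinearMap.ker (toEuclideanLin X))ᗮ)
    (hπV : ∀ᵐ w ∂π, w ∈ (LinearMap.ker (toEuclideanLin X))ᗮ) (k : ℕ) :
    ∃ γ : Measure (EuclideanSpace ℝ (Fin d) × EuclideanSpace ℝ (Fin d)),
      IsProbabilityMeasure γ ∧ γ.fst = (stepLaw X Y α ν)^[k] μ ∧ γ.snd = π ∧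
      (∀ᵐ p ∂γ, p.1 - p.2 ∈ (LinearMap.ker (toEuclideanLin X))ᗮ) ∧
      ∫⁻ p, ‖p.1 - p.2‖ₑ ^ (2 : ℝ) ∂γ ≤ ENNReal.ofReal (Real.exp
          (-(α * (2 - α * τ ^ 2 * ‖Xᵀ * X‖) * sigmaMinPos (weightedGram X ν)))) ^ k
        * ∫⁻ p, ‖p.1 - p.2‖ₑ ^ (2 : ℝ) ∂(μ.prod π) := by
  have := hπ.1
  induction k with
  | zero =>
    refine ⟨μ.prod π, inferInstance, by simp, by simp, ?_, by simp⟩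
    filter_upwards [Measure.quasiMeasurePreserving_fst.ae hμV,
      Measure.quasiMeasurePreserving_snd.ae hπV] with p h1 h2
    exact Submodule.sub_mem _ h1 h2
  | succ k ih =>
    obtain ⟨γ, hγ, h1, h2, h3, h4⟩ := ih
    have hm1 : Measurable fun p : (Fin n → ℝ) × (EuclideanSpace ℝ (Fin d) ×
        EuclideanSpace ℝ (Fin d)) => wgdStep X Y α p.1 p.2.1 :=
      measurable_wgdStep measurable_fst (measurable_fst.comp measurable_snd)
    have hm2 : Measurable fun p : (Fin n → ℝ) × (EuclideanSpace ℝ (Fin d) ×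
        EuclideanSpace ℝ (Fin d)) => wgdStep X Y α p.1 p.2.2 :=
      measurable_wgdStep measurable_fst (measurable_snd.comp measurable_snd)
    obtain ⟨G, hG⟩ : ∃ G : (Fin n → ℝ) × (EuclideanSpace ℝ (Fin d) × EuclideanSpace ℝ (Fin d)) →
        EuclideanSpace ℝ (Fin d) × EuclideanSpace ℝ (Fin d),
        G = fun p => (wgdStep X Y α p.1 p.2.1, wgdStep X Y α p.1 p.2.2) := ⟨_, rfl⟩
    have hm : Measurable G := hG ▸ hm1.prodMk hm2
    refine ⟨(ν.prod γ).map G, Measure.isProbabilityMeasure_map hm.aemeasurable, ?_, ?_, ?_, ?_⟩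
    · have h5 := map_wgdStep_comp_snd (X := X) (Y := Y) (α := α) (ν := ν) (Q := γ) measurable_fst
      rw [← Measure.fst, h1, ← Function.iterate_succ_apply' (stepLaw X Y α ν)] at h5
      rw [← h5, Measure.fst, Measure.map_map measurable_fst hm]
      simp only [Function.comp_def, hG]
    · rw [Measure.snd, Measure.map_map measurable_snd hm]
      have h5 := map_wgdStep_comp_snd (X := X) (Y := Y) (α := α) (ν := ν) (Q := γ) measurable_snd
      rw [← Measure.snd, h2] at h5
      simp only [Function.comp_def, hG]
      rw [h5]
      exact hπ.2
    · rw [ae_map_iff (p := fun p => p.1 - p.2 ∈ (LinearMap.ker (toEuclideanLin X))ᗮ)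
        hm.aemeasurable ((measurable_fst.sub measurable_snd)
          (Submodule.isClosed_orthogonal _).measurableSet)]
      filter_upwards [Measure.quasiMeasurePreserving_snd.ae h3] with p hp
      rw [hG, wgdStep_sub_wgdStep]
      exact Submodule.sub_mem _ hp (Submodule.smul_mem _ _ (gradVec_mem_orthogonal_ker _ _))
    · have hc : Measurable fun p : EuclideanSpace ℝ (Fin d) × EuclideanSpace ℝ (Fin d) =>
          ‖p.1 - p.2‖ₑ ^ (2 : ℝ) := (measurable_fst.sub measurable_snd).enorm.pow_const _
      rw [lintegral_map hc hm]
      simp only [hG]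
      refine (lintegral_wgdStep_sub_wgdStep_le hb hM hα hατ measurable_fst measurable_snd
        h3).trans ((mul_le_mul_right h4 _).trans (le_of_eq (by ring)))

/-- Bounds that are uniform in the law of the weightings: a constant `R` for the norm of `ŵ` and for
the root mean square distance of the stationary law to `ŵ`, and a factor `θ < 1` by which the
stationary law beats the accuracy `ε`. -/
theorem exists_uniform_bounds (X : Matrix (Fin n) (Fin d) ℝ) (Y : EuclideanSpace ℝ (Fin n))
    (hα : 0 < α) :
    ∃ R θ : ℝ, 0 ≤ R ∧ 0 ≤ θ ∧ θ < 1 ∧ ∀ (ν : Measure (Fin n → ℝ)), IsUnit (secondMoment ν) →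
      α < sigmaMinPos (weightedGram X ν) /
        (sigmaMinPos (weightedGram X ν) ^ 2 + ‖X‖ ^ 4 * ‖covSq ν‖) →
      ‖wHat X Y ν‖ ≤ R ∧
      α * noiseForm X ν (Y - toEuclideanLin X (wHat X Y ν)).ofLp / sigmaMinPos (weightedGram X ν)
        ≤ R ^ 2 ∧
      ∀ ε : ℝ, α * (d * ‖covSq ν‖ * ‖Xᵀ * X‖ * ‖Y - toEuclideanLin X (wHat X Y ν)‖ ^ 2)
          ≤ sigmaMinPos (weightedGram X ν) * ε ^ 2 →
        α * noiseForm X ν (Y - toEuclideanLin X (wHat X Y ν)).ofLp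
          / sigmaMinPos (weightedGram X ν) ≤ θ * ε ^ 2 := by
  obtain ⟨C, hC0, hC⟩ := exists_norm_weighted_least_squares_le X Y
  obtain ⟨θ, hθ0, hθ1, hθ⟩ := exists_sum_row_norm_mul_residual_sq_le X
  -- Since α‖X‖⁴‖Σ_D‖ ≤ σ, the bound αQ(r) ≤ α‖Σ_D‖‖X‖²‖r‖² becomes σ(‖r‖/‖X‖)², and ‖r‖ ≤ ‖Y‖ +
  -- ‖X‖C. If X = 0, then Q(r) ≤ 0 and R₁ = 0 suffices.
  set R₁ := (‖Y‖ + ‖X‖ * C) / ‖X‖ with hR₁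
  have hR₁0 : 0 ≤ R₁ := by positivity
  refine ⟨C + R₁, θ, by positivity, hθ0, hθ1, fun ν hM hα2 => ?_⟩
  obtain ⟨hσ, hα3⟩ := step_size_bound hα (by positivity) hα2
  set σ := sigmaMinPos (weightedGram X ν)
  set r := Y - toEuclideanLin X (wHat X Y ν) with hr
  have hres : gradVec X (fun i => (∫ x, x i ^ 2 ∂ν) * r i) = 0 := gradVec_residual_wHat X Y ν
  have hw : ‖wHat X Y ν‖ ≤ C :=
    hC _ _ (secondMoment_pos hM) (wHat_mem_orthogonal_ker X Y ν) hres
  have hQ := noiseForm_le (ν := ν) X r.ofLp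
  refine ⟨by linarith, ?_, fun ε hε => ?_⟩
  · have hrn : ‖r‖ ≤ ‖Y‖ + ‖X‖ * C :=
      (norm_sub_le _ _).trans (add_le_add_right ((norm_toEuclideanLin_le X _).trans
        (mul_le_mul_of_nonneg_left hw (norm_nonneg _))) _)
    have h1 : noiseForm X ν r.ofLp ≤ ‖covSq ν‖ * (‖X‖ ^ 2 * ‖r‖ ^ 2) := by
      refine hQ.trans (mul_le_mul_of_nonneg_left ?_ (norm_nonneg _))
      rw [EuclideanSpace.real_norm_sq_eq, Finset.mul_sum, ← norm_transpose_mul_self]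
      refine Finset.sum_le_sum fun i _ => ?_
      nlinarith [row_norm_sq_le X i, sq_nonneg (r i)]
    have h2 : α * noiseForm X ν r.ofLp ≤ σ * R₁ ^ 2 := by
      rcases eq_or_ne ‖X‖ 0 with h0 | h0
      · rw [h0] at h1
        have h5 : noiseForm X ν r.ofLp ≤ 0 := by simpa using h1
        have h6 : 0 ≤ σ * R₁ ^ 2 := by positivity
        nlinarith
      · have hX : 0 < ‖X‖ := lt_of_le_of_ne (norm_nonneg _) h0.symm
        have h5 : α * (‖X‖ ^ 4 * ‖covSq ν‖) ≤ σ := by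
          have : 0 ≤ α * σ ^ 2 := by positivity
          linarith
        have h6 : ‖X‖ ^ 2 * ‖r‖ ^ 2 ≤ ‖X‖ ^ 4 * R₁ ^ 2 := by
          have h7 : ‖r‖ ≤ ‖X‖ * R₁ := by
            rw [hR₁, mul_div_cancel₀ _ h0]
            exact hrn
          have h8 := pow_le_pow_left₀ (norm_nonneg r) h7 2
          calc ‖X‖ ^ 2 * ‖r‖ ^ 2 ≤ ‖X‖ ^ 2 * (‖X‖ * R₁) ^ 2 :=
                mul_le_mul_of_nonneg_left h8 (sq_nonneg _)
            _ = _ := by ring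
        calc α * noiseForm X ν r.ofLp ≤ α * (‖covSq ν‖ * (‖X‖ ^ 4 * R₁ ^ 2)) :=
              mul_le_mul_of_nonneg_left (h1.trans (mul_le_mul_of_nonneg_left h6 (norm_nonneg _)))
                hα.le
          _ = α * (‖X‖ ^ 4 * ‖covSq ν‖) * R₁ ^ 2 := by ring
          _ ≤ _ := mul_le_mul_of_nonneg_right h5 (sq_nonneg _)
    rw [div_le_iff₀ hσ]
    nlinarith [mul_nonneg hC0 hR₁0, mul_nonneg hC0 hC0]
  · rw [div_le_iff₀ hσ]
    have h1 := hθ _ r (secondMoment_pos hM) hres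
    have h2 := mul_le_mul_of_nonneg_left (hQ.trans (mul_le_mul_of_nonneg_left h1
      (norm_nonneg (covSq ν)))) hα.le
    have h3 := mul_le_mul_of_nonneg_left hε hθ0
    linarith

end Wasserstein

/-! ### The main theorem. -/

/-- C₃ is quantified before ν, which expresses its independence of the law of D beyond τ. The
condition on ε is cleared of its denominator, so that it is void for Σ_D = 0. The index k stands for
the iterate k + 1. -/
theorem mainTheorem3 {n d : ℕ} (X : Matrix (Fin n) (Fin d) ℝ) (Y : EuclideanSpace ℝ (Fin n))
    (α τ : ℝ) (hα : 0 < α) (hατ : α * τ ^ 2 * ‖Xᵀ * X‖ < 2)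
    (μ₁ : Measure (EuclideanSpace ℝ (Fin d))) [IsProbabilityMeasure μ₁]
    (hμ₁ : MemLp id 2 μ₁)
    (hker : ∀ᵐ w ∂μ₁, w ∈ (LinearMap.ker (toEuclideanLin X))ᗮ) :
    ∃ C₃ : ℝ, 0 < C₃ ∧
      ∀ (ν : Measure (Fin n → ℝ)) [IsProbabilityMeasure ν],
        (∀ᵐ δ ∂ν, ‖(diagonal δ : Matrix (Fin n) (Fin n) ℝ)‖ ≤ τ) →
        IsUnit (secondMoment ν) →
        α * ‖weightedGram X ν‖ < 1 →
        α < sigmaMinPos (weightedGram X ν) /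
          (sigmaMinPos (weightedGram X ν) ^ 2 + ‖X‖ ^ 4 * ‖covSq ν‖) →
        Y - toEuclideanLin X (wHat X Y ν) ≠ 0 →
        ∃ μInf : Measure (EuclideanSpace ℝ (Fin d)),
          IsStationaryLaw X Y α ν μInf ∧
          (∀ᵐ w ∂μInf, w ∈ (LinearMap.ker (toEuclideanLin X))ᗮ) ∧
          ∀ {Ω : Type*} [MeasurableSpace Ω] (P : Measure Ω) [IsProbabilityMeasure P]
            (D : ℕ → Ω → Fin n → ℝ) (w₁ : Ω → EuclideanSpace ℝ (Fin d)),
            (∀ k, Measurable (D k)) → Measurable w₁ →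
            (∀ k, P.map (D k) = ν) → P.map w₁ = μ₁ →
            iIndepFun D P → IndepFun w₁ (fun ω k => D k ω) P →
            (∀ k : ℕ, wasserstein 2 (P.map (wgdIter X Y α D w₁ k)) μInf ≤
              ENNReal.ofReal (C₃ * Real.exp
                (-(α * (2 - α * τ ^ 2 * ‖Xᵀ * X‖) * sigmaMinPos (weightedGram X ν) / 2
                  * ((k + 1 : ℕ) : ℝ))))) ∧
            ∀ ε : ℝ, 0 < ε →
              α * (d * ‖covSq ν‖ * ‖Xᵀ * X‖ * ‖Y - toEuclideanLin X (wHat X Y ν)‖ ^ 2)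
                ≤ sigmaMinPos (weightedGram X ν) * ε ^ 2 →
              ∀ k : ℕ,
                2 * Real.log (2 * C₃ / ε) /
                    (α * (2 - α * τ ^ 2 * ‖Xᵀ * X‖) * sigmaMinPos (weightedGram X ν))
                  < ((k + 1 : ℕ) : ℝ) →
                wasserstein 2 (P.map (wgdIter X Y α D w₁ k)) (Measure.dirac (wHat X Y ν))
                  < ENNReal.ofReal ε := by
  obtain ⟨R, θ, hR0, hθ0, hθ1, hunif⟩ := exists_uniform_bounds X Y hα
  have hsqrt0 : 0 ≤ √θ := Real.sqrt_nonneg θ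
  have hsqrt1 : 0 < 1 - √θ := by
    have : √θ < 1 := (Real.sqrt_lt' one_pos).2 (by simpa using hθ1)
    linarith
  set A : ℝ≥0∞ := (∫⁻ w, ‖w‖ₑ ^ (2 : ℝ) ∂μ₁) ^ (1 / 2 : ℝ) with hAdef
  have hA : A ≠ ∞ := by
    have h := hμ₁.eLpNorm_ne_top
    rw [eLpNorm_eq_eLpNorm' two_ne_zero ENNReal.ofNat_ne_top] at h
    simpa [eLpNorm', hAdef] using h
  -- A + 2R bounds the initial L² distance to the stationary law, and 1 ensures positivity. The
  -- factor e pays for the exponent k + 1 after only k contractions, as ακσ/2 ≤ 1.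
  set C₀ : ℝ := Real.exp 1 * (A.toReal + 2 * R + 1) with hC₀def
  have hC₀ : 0 < C₀ := mul_pos (Real.exp_pos _) (by positivity)
  refine ⟨C₀ / (1 - √θ), div_pos hC₀ hsqrt1, ?_⟩
  intro ν _ hτ hM hα1 hα2 _
  have hb := ae_abs_apply_le hτ
  obtain ⟨hwR, hBR, hBε⟩ := hunif ν hM hα2
  obtain ⟨hσ, hα3⟩ := step_size_bound hα (by positivity) hα2
  obtain ⟨π, hπ, hπV, hπB⟩ := exists_isStationaryLaw (Y := Y) hb hM hα hατ hα1 hα2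
  set σ := sigmaMinPos (weightedGram X ν)
  set v := wHat X Y ν
  set κ := 2 - α * τ ^ 2 * ‖Xᵀ * X‖ with hκdef
  set B := α * noiseForm X ν (Y - toEuclideanLin X v).ofLp / σ
  have hκ : 0 < κ := by linarith
  have hc0 : 0 < α * κ * σ := mul_pos (mul_pos hα hκ) hσ
  have hc2 : α * κ * σ ≤ 2 := by
    have h1 : α * σ ≤ 1 := by
      have : 0 ≤ α * (‖X‖ ^ 4 * ‖covSq ν‖) := by positivity
      nlinarith
    have h2 : κ ≤ 2 := by
      have : 0 ≤ α * τ ^ 2 * ‖Xᵀ * X‖ := by positivity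
      linarith
    nlinarith [mul_pos hα hσ]
  have hprob := hπ.1
  refine ⟨π, hπ, hπV, ?_⟩
  intro Ω _ P _ D w₁ hD hw hDν hwμ hind hind'
  have hπv : ∀ b : ℝ, 0 ≤ b → B ≤ b ^ 2 →
      (∫⁻ w, ‖w - v‖ₑ ^ (2 : ℝ) ∂π) ^ (1 / 2 : ℝ) ≤ ENNReal.ofReal b := by
    intro b hb0 hb2
    calc (∫⁻ w, ‖w - v‖ₑ ^ (2 : ℝ) ∂π) ^ (1 / 2 : ℝ)
        ≤ (ENNReal.ofReal (b ^ 2)) ^ (1 / 2 : ℝ) :=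
          ENNReal.rpow_le_rpow (hπB.trans (ENNReal.ofReal_le_ofReal hb2)) (by norm_num)
      _ = ENNReal.ofReal b := by
          rw [ENNReal.ofReal_rpow_of_nonneg (sq_nonneg b) (by norm_num), ← Real.sqrt_eq_rpow,
            Real.sqrt_sq hb0]
  have hinit : (∫⁻ p, ‖p.1 - p.2‖ₑ ^ (2 : ℝ) ∂(μ₁.prod π)) ^ (1 / 2 : ℝ)
      ≤ ENNReal.ofReal (A.toReal + 2 * R) := by
    have h1 := lintegral_sq_rpow_add_le (Q := μ₁.prod π)
      (f := fun p : EuclideanSpace ℝ (Fin d) × EuclideanSpace ℝ (Fin d) => p.1 - v)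
      (g := fun p => v - p.2) (by fun_prop) (by fun_prop)
    have h2 := lintegral_sq_rpow_add_le (Q := μ₁) (f := fun w => w) (g := fun _ => -v)
      (by fun_prop) (by fun_prop)
    have h3 : ∫⁻ p, ‖p.1 - v‖ₑ ^ (2 : ℝ) ∂(μ₁.prod π) = ∫⁻ w, ‖w - v‖ₑ ^ (2 : ℝ) ∂μ₁ := by
      rw [← Measure.fst_prod (μ := μ₁) (ν := π), Measure.fst,
        lintegral_map (by fun_prop) measurable_fst, ← Measure.fst, Measure.fst_prod]
    have h4 : ∫⁻ p, ‖v - p.2‖ₑ ^ (2 : ℝ) ∂(μ₁.prod π) = ∫⁻ w, ‖w - v‖ₑ ^ (2 : ℝ) ∂π := by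
      have h5 : ∀ w : EuclideanSpace ℝ (Fin d), ‖v - w‖ₑ = ‖w - v‖ₑ := fun w => by
        rw [← enorm_neg, neg_sub]
      simp only [h5]
      conv_rhs => rw [← Measure.snd_prod (μ := μ₁) (ν := π), Measure.snd]
      rw [lintegral_map (by fun_prop) measurable_snd]
    have h5 : (∫⁻ _ : EuclideanSpace ℝ (Fin d), ‖-v‖ₑ ^ (2 : ℝ) ∂μ₁) ^ (1 / 2 : ℝ)
        ≤ ENNReal.ofReal R := by
      rw [lintegral_const, measure_univ, mul_one, ← ENNReal.rpow_mul]
      norm_num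
      rw [← ofReal_norm]
      exact ENNReal.ofReal_le_ofReal hwR
    simp only [sub_add_sub_cancel, h3, h4] at h1
    simp only [← sub_eq_add_neg] at h2
    calc _ ≤ _ := h1
      _ ≤ (ENNReal.ofReal A.toReal + ENNReal.ofReal R) + ENNReal.ofReal R := by
          refine add_le_add (h2.trans (add_le_add ?_ h5)) (hπv R hR0 hBR)
          rw [ENNReal.ofReal_toReal hA]
      _ = _ := by
          rw [← ENNReal.ofReal_add ENNReal.toReal_nonneg hR0, ← ENNReal.ofReal_add (by positivity) hR0]
          congr 1
          ring
  have hcoup : ∀ k : ℕ, ∃ γ : Measure (EuclideanSpace ℝ (Fin d) × EuclideanSpace ℝ (Fin d)),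
      IsProbabilityMeasure γ ∧ γ.fst = P.map (wgdIter X Y α D w₁ k) ∧ γ.snd = π ∧
      (∫⁻ p, ‖p.1 - p.2‖ₑ ^ (2 : ℝ) ∂γ) ^ (1 / 2 : ℝ)
        ≤ ENNReal.ofReal (C₀ * Real.exp (-(α * κ * σ / 2 * ((k + 1 : ℕ) : ℝ)))) := by
    intro k
    obtain ⟨γ, hγ, h1, h2, -, h4⟩ := exists_coupling_iterate_stepLaw hb hM hα hατ hπ hker hπV k
    refine ⟨γ, hγ, h1.trans (map_wgdIter hD hw hDν hwμ hind hind' k).symm, h2, ?_⟩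
    refine (ENNReal.rpow_le_rpow h4 (by norm_num)).trans ?_
    rw [ENNReal.mul_rpow_of_nonneg _ _ (by norm_num)]
    refine (mul_le_mul_right hinit _).trans ?_
    rw [← ENNReal.ofReal_pow (Real.exp_pos _).le, ← Real.exp_nat_mul,
      ENNReal.ofReal_rpow_of_nonneg (Real.exp_pos _).le (by norm_num), ← Real.exp_mul,
      ← ENNReal.ofReal_mul (Real.exp_pos _).le]
    refine ENNReal.ofReal_le_ofReal ?_
    have h5 : Real.exp ((k : ℝ) * -(α * κ * σ) * (1 / 2))
        ≤ Real.exp 1 * Real.exp (-(α * κ * σ / 2 * ((k + 1 : ℕ) : ℝ))) := by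
      rw [← Real.exp_add]
      refine Real.exp_le_exp.2 ?_
      push_cast
      linarith
    have h6 : 0 ≤ A.toReal + 2 * R := by positivity
    calc _ ≤ Real.exp 1 * Real.exp (-(α * κ * σ / 2 * ((k + 1 : ℕ) : ℝ)))
          * (A.toReal + 2 * R) := mul_le_mul_of_nonneg_right h5 h6
      _ ≤ Real.exp 1 * Real.exp (-(α * κ * σ / 2 * ((k + 1 : ℕ) : ℝ)))
          * (A.toReal + 2 * R + 1) := mul_le_mul_of_nonneg_left (by linarith) (by positivity)
      _ = _ := by rw [hC₀def]; ring
  have hC₀le : C₀ ≤ C₀ / (1 - √θ) := by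
    rw [le_div_iff₀ hsqrt1]
    nlinarith
  refine ⟨fun k => ?_, fun ε hε hαε k hk => ?_⟩
  · obtain ⟨γ, hγ, h1, h2, h3⟩ := hcoup k
    refine (wasserstein_le 2 h1 h2).trans (h3.trans (ENNReal.ofReal_le_ofReal ?_))
    exact mul_le_mul_of_nonneg_right hC₀le (Real.exp_pos _).le
  · obtain ⟨γ, hγ, h1, h2, h3⟩ := hcoup k
    set e := Real.exp (-(α * κ * σ / 2 * ((k + 1 : ℕ) : ℝ))) with he
    have hprobk : IsProbabilityMeasure (P.map (wgdIter X Y α D w₁ k)) :=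
      Measure.isProbabilityMeasure_map (measurable_wgdIter hD hw k).aemeasurable
    have hsmall : C₀ / (1 - √θ) * e < ε / 2 := by
      have hC₃ : 0 < C₀ / (1 - √θ) := div_pos hC₀ hsqrt1
      rw [div_lt_iff₀ hc0] at hk
      have h4 : Real.log (2 * (C₀ / (1 - √θ)) / ε) < α * κ * σ / 2 * ((k + 1 : ℕ) : ℝ) := by
        linarith
      rw [Real.log_lt_iff_lt_exp (by positivity), div_lt_iff₀ hε] at h4
      rw [he, Real.exp_neg, ← div_eq_mul_inv, div_lt_iff₀ (Real.exp_pos _)]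
      linarith
    -- The factor 1/(1 - √θ) in C₃ makes the transient error fit into the gap that the stationary
    -- error √θ ε leaves below ε.
    have hsmall' : C₀ * e < (1 - √θ) * ε := by
      have h4 := mul_lt_mul_of_pos_left hsmall hsqrt1
      have h5 : (1 - √θ) * (C₀ / (1 - √θ) * e) = C₀ * e := by
        rw [← mul_assoc, mul_div_cancel₀ _ hsqrt1.ne']
      rw [h5] at h4
      nlinarith
    -- Minkowski on the explicit coupling γ replaces the triangle inequality for 𝒲₂, so no gluing of
    -- couplings is needed.
    have h4 := lintegral_sq_rpow_add_le (Q := γ)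
      (f := fun p : EuclideanSpace ℝ (Fin d) × EuclideanSpace ℝ (Fin d) => p.1 - p.2)
      (g := fun p => p.2 - v) (by fun_prop) (by fun_prop)
    simp only [sub_add_sub_cancel] at h4
    have h5 : ∫⁻ p, ‖p.1 - v‖ₑ ^ (2 : ℝ) ∂γ
        = ∫⁻ w, ‖w - v‖ₑ ^ (2 : ℝ) ∂(P.map (wgdIter X Y α D w₁ k)) := by
      rw [← h1, Measure.fst, lintegral_map (by fun_prop) measurable_fst]
    have h6 : ∫⁻ p, ‖p.2 - v‖ₑ ^ (2 : ℝ) ∂γ = ∫⁻ w, ‖w - v‖ₑ ^ (2 : ℝ) ∂π := by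
      rw [← h2, Measure.snd, lintegral_map (by fun_prop) measurable_snd]
    have h7 : (∫⁻ w, ‖w - v‖ₑ ^ (2 : ℝ) ∂π) ^ (1 / 2 : ℝ) ≤ ENNReal.ofReal (√θ * ε) := by
      refine hπv _ (by positivity) ?_
      rw [mul_pow, Real.sq_sqrt hθ0]
      exact hBε ε hαε
    rw [h5, h6] at h4
    calc wasserstein 2 (P.map (wgdIter X Y α D w₁ k)) (Measure.dirac v)
        ≤ ENNReal.ofReal (C₀ * e) + ENNReal.ofReal (√θ * ε) :=
          (wasserstein_dirac_le _ v 2).trans (h4.trans (add_le_add h3 h7))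
      _ = ENNReal.ofReal (C₀ * e + √θ * ε) :=
          (ENNReal.ofReal_add (by positivity) (by positivity)).symm
      _ < ENNReal.ofReal ε := (ENNReal.ofReal_lt_ofReal_iff hε).2 (by linarith)
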